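/- Let $X(t)$, $t\in\mathbb R$, be a measurable, mean-square continuous, real-valued, stationary, zero-mean Gaussian process with spectral density $f$, i.e. $\mathrm{Cov}(X(s),X(t))=\int_{\mathbb R}e^{iu(s-t)}f(u)\,du$ with $0\le f\in L_1(\mathbb R)$, where $$f(\lambda)=\frac{h(\lambda)}{|\lambda^2-s_0^2|^{2\alpha}},\qquad s_0>1,\quad \alpha\in(0,1/2),$$ and $h$ is even, non-negative, bounded and four times continuously differentiable, with $h(0)=1$, $h^{(i)}(0)=0$ for $i=1,2,3,4$, $h>0$ in a neighbourhood of $\pm s_0$, and $\int_{\mathbb R}h(\lambda)(1+|\lambda|)^{-\varepsilon}d\lambda<\infty$ for every $\varepsilon>0$. Let $\psi\in L_1(\mathbb R)$ be real-valued, and suppose that its Fourier transform $\widehat\psi(\lambda)=\int_{\mathbb R}e^{-i\lambda t}\psi(t)\,dt$ is supported in $[-A,A]$ for some $A>0$ and is of bounded variation on $[-A,A]$. Let $(a_j)_{j\in\mathbb N}$ be a strictly increasing unbounded sequence of positive reals, $(m_j)_{j\in\mathbb N}$ an increasing (not necessarily strictly) unbounded sequence of positive integers, and $(b_{jk})_{(j,k)\in\mathbb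 N\times\mathbb Z}$ an array of reals such that $b_{jk}-b_{jl}=\gamma_j(k-l)$ for all $j\in\mathbb N$ and $k,l\in\mathbb Z$, where $\gamma_j>0$, $$\lim_{j\to\infty}\frac{a_j}{\gamma_j}=c\in(0,\infty)\quad\text{and}\quad \lim_{j\to\infty}m_j^2\Big(\frac{\gamma_j}{a_j}-\frac1c\Big)=0 .$$ Put $$\delta_{jk}=\frac1{\sqrt{a_j}}\int_{\mathbb R}\psi\Big(\frac{t-b_{jk}}{a_j}\Big)X(t)\,dt,\qquad \overline\delta_j^{(2,m_j)}=\frac1{m_j}\sum_{k=1}^{m_j}\delta_{jk}^2 .$$ If $\lim_{j\to\infty}m_ja_j^{-4}=0$, then, as $j\to\infty$, the random variables $$\sqrt{m_j}\Big(\overline\delta_j^{(2,m_j)}-s_0^{-4\alpha}\int_{\mathbb R}|\widehat\psi(\eta)|^2\,d\eta\Big)$$ converge in distribution to a centred Gaussian random variable with variance $$\mathcal V_1=4c\pi\, s_0^{-8\alpha}\int_{-c\pi}^{c\pi}\Big|\sum_{n\in\mathbb Z}|\widehat\psi(\eta+2nc\pi)|^2\Big|^2\,d\eta .$$ (For $\psi=0$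 almost everywhere the limit is the point mass at $0$.) -/

import Mathlib

open MeasureTheory ProbabilityTheory Filter Topology Set

noncomputable section

namespace CyclicLongMemory

/-- A (jointly) measurable, zero-mean, real-valued Gaussian process on the real line. -/
structure IsMeasurableCenteredGaussian {Ω : Type*} [MeasurableSpace Ω]
    (P : Measure Ω) (X : ℝ → Ω → ℝ) : Prop where
  measurable : Measurable (fun p : ℝ × Ω => X p.1 p.2)
  gaussian : IsGaussianProcess X P
  mean_zero : ∀ t, ∫ ω, X t ω ∂P = 0

/-- The function `f` is a spectral density of `X`: it is non-negative and integrable, and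
`Cov (X s) (X t) = ∫ exp (i u (s - t)) f u du`. In particular the covariance depends only on
`s - t` and is continuous, so a zero-mean Gaussian process with a spectral density is
stationary and mean-square continuous. -/
structure HasSpectralDensity {Ω : Type*} [MeasurableSpace Ω]
    (P : Measure Ω) (X : ℝ → Ω → ℝ) (f : ℝ → ℝ) : Prop where
  nonneg : ∀ u, 0 ≤ f u
  integrable : Integrable f
  covariance_eq : ∀ s t : ℝ, ((cov[X s, X t; P] : ℝ) : ℂ) =
    ∫ u : ℝ, Complex.exp (Complex.I * (u : ℂ) * ((s - t : ℝ) : ℂ)) * (f u : ℂ)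

/-- `h(u) / |u² - s₀²|^(2α)`; the values at the two poles `u = ± s₀` are irrelevant. -/
def cyclicDensity (h : ℝ → ℝ) (s₀ α : ℝ) (u : ℝ) : ℝ :=
  h u / |u ^ 2 - s₀ ^ 2| ^ (2 * α)

/-- The conditions on the parameters and on `h` in the cyclic long-memory model. -/
structure ModelAssumption (h : ℝ → ℝ) (s₀ α : ℝ) : Prop where
  one_lt : 1 < s₀
  alpha_mem : α ∈ Ioo (0 : ℝ) (1 / 2)
  even : ∀ u, h (-u) = h u
  nonneg : ∀ u, 0 ≤ h u
  bounded : ∃ C, ∀ u, h u ≤ C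
  contDiff : ContDiff ℝ 4 h
  deriv_zero : ∀ i ∈ Finset.Icc 1 4, iteratedDeriv i h 0 = 0
  at_zero : h 0 = 1
  pos_near : (∀ᶠ u in 𝓝 s₀, 0 < h u) ∧ ∀ᶠ u in 𝓝 (-s₀), 0 < h u
  integrable : ∀ ε : ℝ, 0 < ε → Integrable (fun u => h u / (1 + |u|) ^ ε)

/-- The Fourier transform `ψ̂(ξ) = ∫ exp (-i ξ t) ψ(t) dt`. -/
def filterFourier (ψ : ℝ → ℝ) (ξ : ℝ) : ℂ :=
  ∫ t : ℝ, Complex.exp (-(Complex.I * (ξ : ℂ) * (t : ℂ))) * (ψ t : ℂ)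

/-- The conditions on the filter: `ψ ∈ L¹(ℝ)`, and `ψ̂` is supported in `[-A, A]` and of bounded
variation there. -/
structure FilterAssumption (ψ : ℝ → ℝ) (A : ℝ) : Prop where
  integrable : Integrable ψ
  pos : 0 < A
  support : tsupport (filterFourier ψ) ⊆ Icc (-A) A
  boundedVariation : BoundedVariationOn (filterFourier ψ) (Icc (-A) A)

/-- The conditions on the scales `a_j` and the sample sizes `m_j`. -/
structure ScaleAssumption (a : ℕ → ℝ) (m : ℕ → ℕ) : Prop where
  a_pos : ∀ j, 0 < a j
  a_strictMono : StrictMono a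
  a_tendsto : Tendsto a atTop atTop
  m_pos : ∀ j, 0 < m j
  m_mono : Monotone m
  m_tendsto : Tendsto m atTop atTop

/-- The shifts `b_{jk}` are equally spaced at each level `j`, with spacing `γ_j`, and
`a_j / γ_j → c ∈ (0, ∞)`, `m_j² (γ_j / a_j - 1 / c) → 0`. -/
structure ShiftAssumption (a : ℕ → ℝ) (m : ℕ → ℕ) (b : ℕ → ℤ → ℝ) (γ : ℕ → ℝ) (c : ℝ) :
    Prop where
  gamma_pos : ∀ j, 0 < γ j
  spacing : ∀ (j : ℕ) (k l : ℤ), b j k - b j l = γ j * ((k : ℝ) - (l : ℝ))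
  c_pos : 0 < c
  ratio_tendsto : Tendsto (fun j => a j / γ j) atTop (𝓝 c)
  rate : Tendsto (fun j => (m j : ℝ) ^ 2 * (γ j / a j - 1 / c)) atTop (𝓝 0)

/-- The filter transform `δ_{jk} = a_j^(-1/2) ∫ ψ((t - b_{jk}) / a_j) X(t) dt`. -/
def filterTransform {Ω : Type*} (X : ℝ → Ω → ℝ) (ψ : ℝ → ℝ) (a : ℕ → ℝ) (b : ℕ → ℤ → ℝ)
    (j : ℕ) (k : ℤ) (ω : Ω) : ℝ :=
  1 / √(a j) * ∫ t : ℝ, ψ ((t - b j k) / a j) * X t ω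

/-- The averaged statistic `(1 / m_j) ∑_{k = 1}^{m_j} δ_{jk}²`. -/
def meanSquare {Ω : Type*} (X : ℝ → Ω → ℝ) (ψ : ℝ → ℝ) (a : ℕ → ℝ) (b : ℕ → ℤ → ℝ)
    (m : ℕ → ℕ) (j : ℕ) (ω : Ω) : ℝ :=
  1 / (m j : ℝ) * ∑ k ∈ Finset.Icc 1 (m j), filterTransform X ψ a b j (k : ℤ) ω ^ 2

/-- `4 c π s₀^(-8α) ∫_{-cπ}^{cπ} |∑_{n ∈ ℤ} |ψ̂(η + 2 n c π)|²|² dη`. For `ψ̂` of compact support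
and `c > 0` the inner sum has finitely many nonzero terms. -/
def asymptoticVariance (ψ : ℝ → ℝ) (s₀ α c : ℝ) : ℝ :=
  4 * c * Real.pi * s₀ ^ (-8 * α) *
    ∫ η in (-(c * Real.pi))..(c * Real.pi),
      |∑' n : ℤ, ‖filterFourier ψ (η + 2 * (n : ℝ) * c * Real.pi)‖ ^ 2| ^ 2

end CyclicLongMemory

end

/-!
At scale `a_j` the filter transforms `δ_{jk}`, `1 ≤ k ≤ m_j`, form a stretch of a stationary
centred Gaussian sequence. Its covariance matrix is Toeplitz: with `θ_j = γ_j / a_j`, `E δ_{jk}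
δ_{jl} = ∫ f(η / a_j) |ψ̂(η)|² exp (i θ_j (k - l) η) dη` (`integral_filterTransform_mul`), which
after the substitution `x = θ_j η` and periodization is a Fourier coefficient of a symbol `g_j`
on `[-π, π]` (`toeplitzCoeff_scaleSymbol`). Since `ψ̂` has compact support, for large `j` only
values of `f` near the origin, far from its poles, are involved; there `f` is continuous, so the
symbols are uniformly bounded and converge pointwise to the periodization `g` of `c s₀^(-4α)
|ψ̂(c x)|²` (`abs_scaleSymbol_le`, `tendsto_scaleSymbol`).

Gaussianity of the transforms comes from the closed span of the `X_t` in `L²(P)`: all its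
elements are Gaussian, and the pathwise integrals `∫ w(t) X_t dt` belong to it because, by
Fubini's theorem, they are orthogonal to its orthogonal complement
(`integral_mul_mem_gaussianSpace`).

In the eigenbasis of its covariance matrix, the sum of the squares of a Gaussian vector is a
weighted sum of independent `χ²` variables, with the eigenvalues `λ_i` as weights
(`charFun_map_sum_sq_sub`). After centring and division by `√m_j` it is asymptotically normal as
soon as `max |λ_i| / √m_j → 0` and `(∑ λ_i²) / m_j` converges (`tendsto_prod_chiSqCharFun`). The
eigenvalues are bounded because the symbols are. The sum `∑ λ_i²` is the squared Frobenius norm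
of the Toeplitz matrix; divided by `m_j` it lies between nearly full partial sums and the full
sum of the squared Fourier coefficients, and Parseval's identity together with dominated
convergence gives the limit `2π ∫ g²` (`tendsto_sum_sum_sub_div`, `tendsto_charFun_sum_sq`).
Hence the limiting variance is `4π ∫ g²`, which is `asymptoticVariance`
(`asymptoticVariance_eq`).

What remains is the deterministic bias. The density `f` is even and twice differentiable at `0`,
so it differs from `f(0) = s₀^(-4α)` by a quadratic error, and the bias is `O(√m_j a_j⁻²) → 0`
(`tendsto_bias`).
-/

namespace CyclicLongMemory

/-! ### The Gaussian space of a process -/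

/-- The closed linear span in `L²(P)` of the random variables `X t`. -/
noncomputable def gaussianSpace {Ω T : Type*} [MeasurableSpace Ω] (P : Measure Ω)
    (X : T → Ω → ℝ) : Submodule ℝ (Lp ℝ 2 P) :=
  (Submodule.span ℝ {Y : Lp ℝ 2 P | ∃ t, Y =ᵐ[P] X t}).topologicalClosure

section GaussianSpace

variable {Ω T : Type*} [MeasurableSpace Ω] {P : Measure Ω} [IsProbabilityMeasure P] {X : T → Ω → ℝ}

lemma hasGaussianLaw_of_mem_span (hX : IsGaussianProcess X P) (h0 : ∀ t, ∫ ω, X t ω ∂P = 0)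
    {Y : Lp ℝ 2 P} (hY : Y ∈ Submodule.span ℝ {Y : Lp ℝ 2 P | ∃ t, Y =ᵐ[P] X t}) :
    HasGaussianLaw Y P ∧ ∫ ω, Y ω ∂P = 0 := by
  classical
  -- membership in the span means being a finite linear combination of the `X t`
  have key : ∃ (I : Finset T) (c : T → ℝ), Y =ᵐ[P] fun ω => ∑ t ∈ I, c t * X t ω := by
    induction hY using Submodule.span_induction with
    | mem x h =>
      obtain ⟨t, ht⟩ := h
      exact ⟨{t}, 1, by simpa using ht⟩
    | zero => exact ⟨∅, 0, by
      filter_upwards [Lp.coeFn_zero ℝ 2 P] with ω _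
      simp⟩
    | add x y _ _ hx hy =>
      obtain ⟨I, c, hc⟩ := hx
      obtain ⟨J, d, hd⟩ := hy
      refine ⟨I ∪ J, fun t => (if t ∈ I then c t else 0) + (if t ∈ J then d t else 0), ?_⟩
      filter_upwards [Lp.coeFn_add x y, hc, hd] with ω h1 h2 h3
      simp only [h1, Pi.add_apply, h2, h3, add_mul, ite_mul, zero_mul, Finset.sum_add_distrib,
        Finset.sum_ite_mem]
      congr 2
      · rw [Finset.union_inter_cancel_left]
      · rw [Finset.union_inter_cancel_right]
    | smul r x _ hx =>
      obtain ⟨I, c, hc⟩ := hx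
      refine ⟨I, fun t => r * c t, ?_⟩
      filter_upwards [Lp.coeFn_smul r x, hc] with ω h1 h2
      simp [h1, h2, Finset.mul_sum, mul_assoc]
  obtain ⟨I, c, hc⟩ := key
  have hg : HasGaussianLaw (fun ω => ∑ t ∈ I, c t * X t ω) P := by
    let L : (I → ℝ) →L[ℝ] ℝ := ∑ t : I, c t • ContinuousLinearMap.proj (R := ℝ) t
    have hL : (fun ω => ∑ t ∈ I, c t * X t ω) = fun ω => L (I.restrict (X · ω)) := by
      ext ω
      simp [L, ← Finset.sum_coe_sort I (fun t => c t * X t ω)]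
    rw [hL]
    exact (hX.hasGaussianLaw I).map_fun L
  refine ⟨hg.congr hc.symm, ?_⟩
  rw [integral_congr_ae hc, integral_finsetSum]
  · simp [integral_const_mul, h0]
  · exact fun t _ => (hX.hasGaussianLaw_eval t).integrable.const_mul _

/-- Every element of the Gaussian space is a centred Gaussian variable: weak limits of centred
Gaussian laws with convergent variances are centred Gaussian. -/
lemma charFun_map_of_mem_gaussianSpace (hX : IsGaussianProcess X P)
    (h0 : ∀ t, ∫ ω, X t ω ∂P = 0) {Y : Lp ℝ 2 P} (hY : Y ∈ gaussianSpace P X) (t : ℝ) :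
    charFun (P.map Y) t = Complex.exp (-(‖Y‖ ^ 2 * t ^ 2 / 2 : ℝ)) := by
  obtain ⟨y, hy, hlim⟩ := mem_closure_iff_seq_limit.1 hY
  have hmeas (Z : Lp ℝ 2 P) : AEMeasurable Z P := (Lp.aestronglyMeasurable Z).aemeasurable
  have h1 (n : ℕ) : charFun (P.map (y n)) t = Complex.exp (-(‖y n‖ ^ 2 * t ^ 2 / 2 : ℝ)) := by
    obtain ⟨hg, hm⟩ := hasGaussianLaw_of_mem_span hX h0 (hy n)
    have hv : Var[y n; P] = ‖y n‖ ^ 2 := by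
      rw [variance_of_integral_eq_zero (hmeas _) hm, ← real_inner_self_eq_norm_sq, L2.inner_def]
      simp [pow_two]
    rw [hg.map_eq_gaussianReal, charFun_gaussianReal, hm, Real.coe_toNNReal _ (variance_nonneg _ _),
      hv]
    push_cast
    congr 1
    ring
  -- convergence in `L²` gives convergence in law, hence of characteristic functions; the variances
  -- `‖y n‖ ^ 2` converge as well
  have hD := (tendstoInMeasure_of_tendsto_Lp hlim).tendstoInDistribution (fun n => hmeas (y n))
  have h2 := ProbabilityMeasure.tendsto_iff_tendsto_charFun.1 hD.tendsto t
  refine tendsto_nhds_unique h2 ?_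
  simp only [ProbabilityMeasure.coe_mk, h1]
  have h3 : Tendsto (fun n => ‖y n‖) atTop (𝓝 ‖Y‖) := hlim.norm
  have h4 : Continuous fun r : ℝ => Complex.exp (-(r ^ 2 * t ^ 2 / 2 : ℝ)) := by fun_prop
  exact (h4.tendsto _).comp h3

lemma map_eq_gaussianReal_of_mem_gaussianSpace (hX : IsGaussianProcess X P)
    (h0 : ∀ t, ∫ ω, X t ω ∂P = 0) {Y : Lp ℝ 2 P} (hY : Y ∈ gaussianSpace P X) :
    P.map Y = gaussianReal 0 (‖Y‖ ^ 2).toNNReal := by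
  have : IsProbabilityMeasure (P.map Y) :=
    Measure.isProbabilityMeasure_map (Lp.aestronglyMeasurable Y).aemeasurable
  refine Measure.ext_of_charFun (funext fun t => ?_)
  rw [charFun_map_of_mem_gaussianSpace hX h0 hY, charFun_gaussianReal,
    Real.coe_toNNReal _ (by positivity)]
  push_cast
  congr 1
  ring

lemma integral_eq_zero_of_mem_gaussianSpace (hX : IsGaussianProcess X P)
    (h0 : ∀ t, ∫ ω, X t ω ∂P = 0) {Y : Ω → ℝ} (hL : MemLp Y 2 P)
    (hY : hL.toLp ∈ gaussianSpace P X) : ∫ ω, Y ω ∂P = 0 := by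
  rw [← integral_congr_ae hL.coeFn_toLp, ← integral_map (f := fun x => x)
    (Lp.aestronglyMeasurable _).aemeasurable (by fun_prop),
    map_eq_gaussianReal_of_mem_gaussianSpace hX h0 hY]
  simp

/-- A finite family of elements of the Gaussian space is jointly Gaussian. -/
lemma hasGaussianLaw_pi_of_mem_gaussianSpace {ι : Type*} [Fintype ι] (hX : IsGaussianProcess X P)
    (h0 : ∀ t, ∫ ω, X t ω ∂P = 0) {Y : ι → Ω → ℝ} (hL : ∀ i, MemLp (Y i) 2 P)
    (hY : ∀ i, (hL i).toLp ∈ gaussianSpace P X) :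
    HasGaussianLaw (fun ω i => Y i ω) P := by
  classical
  have hm : AEMeasurable (fun ω i => Y i ω) P :=
    aemeasurable_pi_iff.2 fun i => (hL i).aestronglyMeasurable.aemeasurable
  have : IsProbabilityMeasure (P.map fun ω i => Y i ω) := Measure.isProbabilityMeasure_map hm
  refine ⟨⟨fun L => ?_⟩⟩
  -- a linear functional of the family is again an element of the Gaussian space
  let Z : Lp ℝ 2 P := ∑ i, L (Pi.single i 1) • (hL i).toLp
  have hZ : Z ∈ gaussianSpace P X :=
    Submodule.sum_mem _ fun i _ => Submodule.smul_mem _ _ (hY i)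
  have hZe : Z =ᵐ[P] fun ω => L (fun i => Y i ω) := by
    have h1 : ∀ᵐ ω ∂P, ∀ i, (L (Pi.single i 1) • (hL i).toLp : Lp ℝ 2 P) ω
        = L (Pi.single i 1) * Y i ω := by
      refine ae_all_iff.2 fun i => ?_
      filter_upwards [Lp.coeFn_smul (L (Pi.single i 1)) (hL i).toLp, (hL i).coeFn_toLp]
        with ω h2 h3
      simp [h2, h3]
    filter_upwards [h1, Lp.coeFn_finsetSum Finset.univ
      fun i => L (Pi.single i 1) • (hL i).toLp] with ω h2 h3
    rw [h3, Finset.sum_apply]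
    simp_rw [h2]
    conv_rhs => rw [← L.sum_comp_single]
    refine Finset.sum_congr rfl fun i _ => ?_
    have h4 : Pi.single i (Y i ω) = Y i ω • (Pi.single i 1 : ι → ℝ) := by
      rw [← Pi.single_smul, smul_eq_mul, mul_one]
    simp [h4, mul_comm]
  rw [AEMeasurable.map_map_of_aemeasurable (by fun_prop) hm]
  have h4 : P.map (⇑L ∘ fun ω i => Y i ω) = P.map Z := Measure.map_congr hZe.symm
  have h5 := map_eq_gaussianReal_of_mem_gaussianSpace hX h0 hZ
  have hZm : AEMeasurable Z P := (Lp.aestronglyMeasurable Z).aemeasurable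
  have h6 : ∫ x, L x ∂(P.map fun ω i => Y i ω) = 0 := by
    rw [integral_map hm (by fun_prop), ← integral_congr_ae hZe,
      ← integral_map (f := fun x => x) hZm (by fun_prop), h5]
    simp
  have h7 : Var[L; P.map fun ω i => Y i ω] = ‖Z‖ ^ 2 := by
    rw [variance_map (by fun_prop) hm]
    change Var[fun ω => L (fun i => Y i ω); P] = _
    rw [← variance_congr hZe, ← Function.id_comp Z, ← variance_map (by fun_prop) hZm, h5]
    simp
  rw [h4, h5, h6, h7]

end GaussianSpace

/-! ### Integrals of the process -/

section Integrals

variable {Ω : Type*} [MeasurableSpace Ω] {P : Measure Ω} {X : ℝ → Ω → ℝ}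
  {w v : ℝ → ℝ} {R : ℝ}

lemma integral_norm_mul_norm_le {U V : Ω → ℝ} (hU : MemLp U 2 P) (hV : MemLp V 2 P) :
    ∫ ω, ‖U ω‖ * ‖V ω‖ ∂P ≤ (∫ ω, U ω ^ 2 ∂P) / 2 + (∫ ω, V ω ^ 2 ∂P) / 2 := by
  rw [← integral_div, ← integral_div,
    ← integral_add (hU.integrable_sq.div_const _) (hV.integrable_sq.div_const _)]
  refine integral_mono ?_ ((hU.integrable_sq.div_const _).add (hV.integrable_sq.div_const _))
    fun ω => ?_
  · simpa using (hU.integrable_mul hV).norm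
  · have := sq_nonneg (‖U ω‖ - ‖V ω‖)
    have h1 : ‖U ω‖ ^ 2 = U ω ^ 2 := by simp
    have h2 : ‖V ω‖ ^ 2 = V ω ^ 2 := by simp
    simp only
    linarith

lemma aestronglyMeasurable_integral_mul [SFinite P] (hm : Measurable fun p : ℝ × Ω => X p.1 p.2)
    (hw : Integrable w) : AEStronglyMeasurable (fun ω => ∫ t, w t * X t ω) P := by
  have h : AEStronglyMeasurable (fun p : Ω × ℝ => w p.2 * X p.2 p.1) (P.prod volume) :=
    (hw.aestronglyMeasurable.comp_snd).mul
      (hm.comp measurable_swap).aestronglyMeasurable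
  exact h.integral_prod_right'

variable [IsProbabilityMeasure P]

/-- The joint integrability behind all uses of Fubini's theorem below: `E |X_s X_t| ≤ R` by
`|xy| ≤ (x² + y²) / 2`. -/
lemma integrable_mul_mul (hX : IsMeasurableCenteredGaussian P X)
    (hR : ∀ t, ∫ ω, X t ω ^ 2 ∂P ≤ R) (hw : Integrable w) (hv : Integrable v) :
    Integrable (fun p : (ℝ × ℝ) × Ω => w p.1.1 * v p.1.2 * (X p.1.1 p.2 * X p.1.2 p.2))
      ((volume.prod volume).prod P) := by
  have hL (t) : MemLp (X t) 2 P := (hX.gaussian.hasGaussianLaw_eval t).memLp_two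
  have hwv : Integrable (fun p : ℝ × ℝ => w p.1 * v p.2) (volume.prod volume) := hw.mul_prod hv
  have hXX : Measurable (fun p : (ℝ × ℝ) × Ω => X p.1.1 p.2 * X p.1.2 p.2) :=
    (hX.measurable.comp (measurable_fst.fst.prodMk measurable_snd)).mul
      (hX.measurable.comp (measurable_fst.snd.prodMk measurable_snd))
  have hme : AEStronglyMeasurable
      (fun p : (ℝ × ℝ) × Ω => w p.1.1 * v p.1.2 * (X p.1.1 p.2 * X p.1.2 p.2))
      ((volume.prod volume).prod P) :=
    hwv.aestronglyMeasurable.comp_fst.mul hXX.aestronglyMeasurable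
  refine (integrable_prod_iff hme).2 ⟨Eventually.of_forall fun p => ?_, ?_⟩
  · exact ((hL p.1).integrable_mul (hL p.2)).const_mul (w p.1 * v p.2)
  · refine (hwv.norm.mul_const R).mono' hme.norm.integral_prod_right' (Eventually.of_forall ?_)
    intro p
    simp only [norm_mul, integral_const_mul, norm_norm]
    rw [Real.norm_of_nonneg (integral_nonneg fun ω => by positivity)]
    gcongr
    linarith [integral_norm_mul_norm_le (hL p.1) (hL p.2), hR p.1, hR p.2]

/-- Product moments of the pathwise integrals `∫ w(t) X_t dt` and `∫ v(t) X_t dt`. -/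
lemma integrable_integral_mul_integral (hX : IsMeasurableCenteredGaussian P X)
    (hR : ∀ t, ∫ ω, X t ω ^ 2 ∂P ≤ R) (hw : Integrable w) (hv : Integrable v) :
    Integrable (fun ω => (∫ s, w s * X s ω) * ∫ t, v t * X t ω) P ∧
    ∫ ω, (∫ s, w s * X s ω) * (∫ t, v t * X t ω) ∂P =
      ∫ p : ℝ × ℝ, w p.1 * v p.2 * ∫ ω, X p.1 ω * X p.2 ω ∂P := by
  have hI := integrable_mul_mul hX hR hw hv
  have he (ω : Ω) : (∫ p : ℝ × ℝ, w p.1 * v p.2 * (X p.1 ω * X p.2 ω)) =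
      (∫ s, w s * X s ω) * ∫ t, v t * X t ω := by
    rw [← integral_prod_mul, ← Measure.volume_eq_prod]
    congr with p
    ring
  constructor
  · simp only [← he]
    exact hI.integral_prod_right
  · simp only [← he, ← integral_const_mul]
    exact (integral_integral_swap hI).symm

lemma memLp_integral_mul (hX : IsMeasurableCenteredGaussian P X)
    (hR : ∀ t, ∫ ω, X t ω ^ 2 ∂P ≤ R) (hw : Integrable w) :
    MemLp (fun ω => ∫ t, w t * X t ω) 2 P := by
  rw [memLp_two_iff_integrable_sq (aestronglyMeasurable_integral_mul hX.measurable hw)]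
  simpa only [pow_two] using (integrable_integral_mul_integral hX hR hw hw).1

/-- The pathwise integral `∫ w(t) X_t dt` lies in the Gaussian space: by Fubini it is orthogonal to
everything that is orthogonal to all `X_t`. -/
lemma integral_mul_mem_gaussianSpace (hX : IsMeasurableCenteredGaussian P X)
    (hR : ∀ t, ∫ ω, X t ω ^ 2 ∂P ≤ R) (hw : Integrable w) :
    (memLp_integral_mul hX hR hw).toLp ∈ gaussianSpace P X := by
  have hL (t) : MemLp (X t) 2 P := (hX.gaussian.hasGaussianLaw_eval t).memLp_two
  rw [gaussianSpace, ← Submodule.orthogonal_orthogonal_eq_closure, Submodule.mem_orthogonal]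
  intro Z hZ
  have hZL : MemLp Z 2 P := Lp.memLp Z
  have hZt (t : ℝ) : ∫ ω, Z ω * X t ω ∂P = 0 := by
    have h1 := (Submodule.mem_orthogonal' _ _).1 hZ (hL t).toLp
      (Submodule.subset_span ⟨t, (hL t).coeFn_toLp⟩)
    rw [L2.inner_def] at h1
    rw [← h1]
    refine integral_congr_ae ?_
    filter_upwards [(hL t).coeFn_toLp] with ω h
    simp [h, mul_comm]
  have hme : AEStronglyMeasurable (fun p : ℝ × Ω => w p.1 * (Z p.2 * X p.1 p.2))
      (volume.prod P) :=
    hw.aestronglyMeasurable.comp_fst.mul (hZL.aestronglyMeasurable.comp_snd.mul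
      hX.measurable.aestronglyMeasurable)
  have hI : Integrable (fun p : ℝ × Ω => w p.1 * (Z p.2 * X p.1 p.2)) (volume.prod P) := by
    refine (integrable_prod_iff hme).2 ⟨Eventually.of_forall fun t => ?_, ?_⟩
    · exact (hZL.integrable_mul (hL t)).const_mul (w t)
    · refine (hw.norm.mul_const ((∫ ω, Z ω ^ 2 ∂P) / 2 + R / 2)).mono'
        hme.norm.integral_prod_right' (Eventually.of_forall fun t => ?_)
      simp only [norm_mul, integral_const_mul, norm_norm]
      rw [Real.norm_of_nonneg (integral_nonneg fun ω => by positivity)]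
      gcongr
      linarith [integral_norm_mul_norm_le hZL (hL t), hR t]
  rw [L2.inner_def]
  calc ∫ ω, inner ℝ (Z ω) 
          ((MemLp.toLp (fun ω => ∫ t, w t * X t ω) (memLp_integral_mul hX hR hw) : Lp ℝ 2 P) ω) ∂P
      = ∫ ω, (∫ t, w t * (Z ω * X t ω)) ∂P := by
        refine integral_congr_ae ?_
        filter_upwards [(memLp_integral_mul hX hR hw).coeFn_toLp] with ω h
        rw [h]
        rw [RCLike.inner_apply, conj_trivial, ← integral_mul_const]
        congr with t
        ring
    _ = ∫ t, (∫ ω, w t * (Z ω * X t ω) ∂P) := (integral_integral_swap hI).symm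
    _ = 0 := by simp [integral_const_mul, hZt]

end Integrals

/-! ### Weighted sums of independent chi-squared variables -/

section QuadraticForm

lemma integral_sq_gaussianReal : ∫ z, z ^ 2 ∂(gaussianReal 0 1) = 1 := by
  have h := variance_id_gaussianReal (μ := 0) (v := 1)
  rw [variance_of_integral_eq_zero (by fun_prop) (by simp)] at h
  simpa using h

lemma integrable_pow_gaussianReal (n : ℕ) : Integrable (fun z : ℝ => z ^ n) (gaussianReal 0 1) := by
  have h := (memLp_id_gaussianReal (μ := 0) (v := 1) n).integrable_norm_pow'
  exact h.mono' (by fun_prop) (by simp)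

/-- The fourth moment is obtained from `(Z₁ + Z₂)/√2 ∼ Z₁` for independent standard normal
`Z₁, Z₂`. -/
lemma integral_pow_four_gaussianReal : ∫ z, z ^ 4 ∂(gaussianReal 0 1) = 3 := by
  set μ := gaussianReal 0 1
  have hI := integrable_pow_gaussianReal
  have hconv : (μ.prod μ).map (fun p => p.1 + p.2) = μ.map (fun z => √2 * z) := by
    have h1 := gaussianReal_conv_gaussianReal (m₁ := 0) (m₂ := 0) (v₁ := 1) (v₂ := 1)
    have h2 := gaussianReal_map_const_mul (μ := 0) (v := 1) √2
    rw [Measure.conv] at h1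
    rw [h1, h2]
    congr 1
    · simp
    · ext
      norm_num
  have hl : ∫ z, z ^ 4 ∂((μ.prod μ).map fun p => p.1 + p.2) =
      2 * (∫ z, z ^ 4 ∂μ) + 6 := by
    rw [integral_map (by fun_prop) (by fun_prop)]
    have hm : ∀ i j : ℕ, Integrable (fun p : ℝ × ℝ => p.1 ^ i * p.2 ^ j) (μ.prod μ) :=
      fun i j => (hI i).mul_prod (hI j)
    have hv : ∀ i j : ℕ, ∫ p : ℝ × ℝ, p.1 ^ i * p.2 ^ j ∂(μ.prod μ) =
        (∫ z, z ^ i ∂μ) * ∫ z, z ^ j ∂μ := fun i j =>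
      integral_prod_mul (fun z : ℝ => z ^ i) (fun z : ℝ => z ^ j)
    have h1 : ∫ z, z ^ 1 ∂μ = 0 := by simp [μ]
    have h0 : ∫ z, z ^ 0 ∂μ = 1 := by simp
    calc ∫ p : ℝ × ℝ, (p.1 + p.2) ^ 4 ∂(μ.prod μ)
        = ∫ p : ℝ × ℝ, ∑ k ∈ Finset.range 5,
            (Nat.choose 4 k : ℝ) * (p.1 ^ k * p.2 ^ (4 - k)) ∂(μ.prod μ) := by
          refine integral_congr_ae (Eventually.of_forall fun p => ?_)
          simp only [add_pow]
          exact Finset.sum_congr rfl fun k _ => by ring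
      _ = ∑ k ∈ Finset.range 5,
            (Nat.choose 4 k : ℝ) * ((∫ z, z ^ k ∂μ) * ∫ z, z ^ (4 - k) ∂μ) := by
          rw [integral_finsetSum _ fun k _ => (hm _ _).const_mul _]
          simp_rw [integral_const_mul, hv]
      _ = _ := by
          simp only [Finset.sum_range_succ, Finset.sum_range_zero, Nat.sub_zero, Nat.sub_self,
            Nat.reduceSub, h0, h1, show ∫ z, z ^ 2 ∂μ = 1 from integral_sq_gaussianReal]
          norm_num [Nat.choose]
          ring
  have hr : ∫ z, z ^ 4 ∂(μ.map fun z => √2 * z) = 4 * ∫ z, z ^ 4 ∂μ := by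
    rw [integral_map (by fun_prop) (by fun_prop), ← integral_const_mul]
    refine integral_congr_ae (Eventually.of_forall fun z => ?_)
    have h4 : √2 ^ 4 = 4 := by
      rw [show (4 : ℕ) = 2 * 2 from rfl, pow_mul, Real.sq_sqrt (by norm_num)]
      norm_num
    simp only [mul_pow, h4]
  rw [hconv, hr] at hl
  linarith

/-- The characteristic function of `Z² - 1`, where `Z` is standard normal. -/
noncomputable def chiSqCharFun (s : ℝ) : ℂ :=
  charFun ((gaussianReal 0 1).map fun z => z ^ 2 - 1) s

lemma norm_chiSqCharFun_le (s : ℝ) : ‖chiSqCharFun s‖ ≤ 1 := by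
  have : IsProbabilityMeasure ((gaussianReal 0 1).map fun z => z ^ 2 - 1) :=
    Measure.isProbabilityMeasure_map (by fun_prop)
  exact norm_charFun_le_one s

/-- Near `0` the law of `Z² - 1` agrees with the centred Gaussian law of variance `2` to second
order. -/
lemma chiSqCharFun_sub_exp_isLittleO :
    (fun s : ℝ => chiSqCharFun s - Complex.exp (-(s ^ 2 : ℝ))) =o[𝓝 0] fun s => s ^ 2 := by
  -- `(Z ^ 2 - 1) / √2` is standardized, so its characteristic function is
  -- `1 - s ^ 2 / 2 + o(s ^ 2)`
  have h0 : ∫ z, (z ^ 2 - 1) / √2 ∂(gaussianReal 0 1) = 0 := by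
    rw [integral_div, integral_sub (integrable_pow_gaussianReal 2) (integrable_const _),
      integral_sq_gaussianReal]
    simp
  have h1 : ∫ z, ((z ^ 2 - 1) / √2) ^ 2 ∂(gaussianReal 0 1) = 1 := by
    have he (z : ℝ) : ((z ^ 2 - 1) / √2) ^ 2 = (z ^ 4 - 2 * z ^ 2 + 1) / 2 := by
      rw [div_pow, Real.sq_sqrt (by norm_num)]
      ring
    simp_rw [he]
    have h3 : Integrable (fun z : ℝ => z ^ 4 - 2 * z ^ 2) (gaussianReal 0 1) :=
      (integrable_pow_gaussianReal 4).sub ((integrable_pow_gaussianReal 2).const_mul 2)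
    rw [integral_div, integral_add h3 (integrable_const _),
      integral_sub (integrable_pow_gaussianReal 4) ((integrable_pow_gaussianReal 2).const_mul 2),
      integral_const_mul, integral_sq_gaussianReal, integral_pow_four_gaussianReal]
    norm_num
  have h2 := taylor_charFun_two (P := gaussianReal 0 1) (X := fun z => (z ^ 2 - 1) / √2)
    (by fun_prop) h0 h1
  have h3 : Tendsto (fun s : ℝ => √2 * s) (𝓝 0) (𝓝 0) := by
    have : Continuous fun s : ℝ => √2 * s := by fun_prop
    simpa using this.tendsto 0
  have h4 := h2.comp_tendsto h3
  have h5 : (fun s : ℝ => chiSqCharFun s - (1 - (s ^ 2 : ℝ))) =o[𝓝 0] fun s => s ^ 2 := by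
    have h6 : (fun s : ℝ => (√2 * s) ^ 2) =O[𝓝 0] fun s => s ^ 2 := by
      simp_rw [mul_pow]
      exact Asymptotics.isBigO_const_mul_self _ _ _
    refine (h4.trans_isBigO h6).congr_left fun s => ?_
    have h7 : charFun ((gaussianReal 0 1).map fun z => (z ^ 2 - 1) / √2) (√2 * s) =
        chiSqCharFun s := by
      have h8 : (fun z : ℝ => (z ^ 2 - 1) / √2) = fun z => (√2)⁻¹ * (z ^ 2 - 1) := by
        ext z
        ring
      rw [chiSqCharFun, h8, charFun_map_mul_comp (by fun_prop)]
      congr 1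
      field_simp
    simp only [Function.comp_apply, h7]
    congr 2
    push_cast
    rw [mul_pow, ← Complex.ofReal_pow √2, Real.sq_sqrt (by norm_num)]
    push_cast
    ring
  have h9 : (fun s : ℝ => Complex.exp (-(s ^ 2 : ℝ)) - (1 - (s ^ 2 : ℝ))) =o[𝓝 0]
      fun s => s ^ 2 := by
    have h10 : (fun z : ℂ => Complex.exp z - 1 - z) =o[𝓝 0] fun z => z := by
      have := (Complex.hasDerivAt_exp 0).isLittleO
      simpa using this
    have h11 : Tendsto (fun s : ℝ => (-(s ^ 2 : ℝ) : ℂ)) (𝓝 0) (𝓝 0) := by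
      have : Continuous fun s : ℝ => (-(s ^ 2 : ℝ) : ℂ) := by fun_prop
      simpa using this.tendsto 0
    have h12 := (h10.comp_tendsto h11).norm_right
    refine (h12.congr_left fun s => ?_).congr_right fun s => ?_
    · simp only [Function.comp_apply]
      ring
    · simp
  refine (h5.sub h9).congr_left fun s => ?_
  ring

/-- Products of numbers in the unit disc depend on their factors in a `1`-Lipschitz way. -/
lemma norm_prod_sub_prod_le {ι : Type*} (s : Finset ι) (f g : ι → ℂ)
    (hf : ∀ i ∈ s, ‖f i‖ ≤ 1) (hg : ∀ i ∈ s, ‖g i‖ ≤ 1) :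
    ‖∏ i ∈ s, f i - ∏ i ∈ s, g i‖ ≤ ∑ i ∈ s, ‖f i - g i‖ := by
  classical
  induction s using Finset.induction_on with
  | empty => simp
  | insert a s ha ih =>
    rw [Finset.prod_insert ha, Finset.prod_insert ha, Finset.sum_insert ha]
    have h1 : ‖∏ i ∈ s, f i‖ ≤ 1 := by
      rw [norm_prod]
      exact Finset.prod_le_one (fun _ _ => norm_nonneg _)
        fun i hi => hf i (Finset.mem_insert_of_mem hi)
    have h2 := ih (fun i hi => hf i (Finset.mem_insert_of_mem hi))
      fun i hi => hg i (Finset.mem_insert_of_mem hi)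
    calc ‖f a * ∏ i ∈ s, f i - g a * ∏ i ∈ s, g i‖
        = ‖(f a - g a) * ∏ i ∈ s, f i + g a * (∏ i ∈ s, f i - ∏ i ∈ s, g i)‖ := by ring_nf
      _ ≤ ‖f a - g a‖ * ‖∏ i ∈ s, f i‖ + ‖g a‖ * ‖∏ i ∈ s, f i - ∏ i ∈ s, g i‖ := by
          refine (norm_add_le _ _).trans ?_
          rw [norm_mul, norm_mul]
      _ ≤ ‖f a - g a‖ * 1 + 1 * ∑ i ∈ s, ‖f i - g i‖ := by
          gcongr
          exact hg a (Finset.mem_insert_self a s)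
      _ = _ := by ring

/-- A Lindeberg-type limit theorem for weighted sums of independent centred `χ²` variables, in terms
of characteristic functions. -/
lemma tendsto_prod_chiSqCharFun {ι : ℕ → Type*} [∀ n, Fintype (ι n)] (s : ∀ n, ι n → ℝ)
    (ε : ℕ → ℝ) (hε : Tendsto ε atTop (𝓝 0)) (hs : ∀ᶠ n in atTop, ∀ i, |s n i| ≤ ε n) {v : ℝ}
    (hv : Tendsto (fun n => ∑ i, s n i ^ 2) atTop (𝓝 v)) :
    Tendsto (fun n => ∏ i, chiSqCharFun (s n i)) atTop (𝓝 (Complex.exp (-(v : ℝ)))) := by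
  have h1 : Tendsto (fun n => ∏ i, Complex.exp (-(s n i ^ 2 : ℝ))) atTop
      (𝓝 (Complex.exp (-(v : ℝ)))) := by
    have h : Continuous fun r : ℝ => Complex.exp (-(r : ℝ)) := by fun_prop
    refine ((h.tendsto v).comp hv).congr fun n => ?_
    simp [← Complex.exp_sum]
  have hv1 : 0 < |v| + 1 := by positivity
  have h2 : Tendsto (fun n => ∏ i, chiSqCharFun (s n i) - ∏ i, Complex.exp (-(s n i ^ 2 : ℝ)))
      atTop (𝓝 0) := by
    rw [Metric.tendsto_nhds]
    intro e he
    -- each factor costs at most a small multiple of `s n i ^ 2`, and these squares have bounded sum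
    have h3 := chiSqCharFun_sub_exp_isLittleO.def (c := e / 2 / (|v| + 1)) (by positivity)
    obtain ⟨δ, hδ, h4⟩ := Metric.eventually_nhds_iff.1 h3
    filter_upwards [hs, (tendsto_order.1 hε).2 δ hδ,
      (tendsto_order.1 hv).2 (|v| + 1) (by linarith [le_abs_self v])] with n h5 h6 h7
    rw [dist_zero_right]
    calc _ ≤ ∑ i, ‖chiSqCharFun (s n i) - Complex.exp (-(s n i ^ 2 : ℝ))‖ := by
          refine norm_prod_sub_prod_le _ _ _ (fun i _ => norm_chiSqCharFun_le _) fun i _ => ?_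
          rw [← Complex.ofReal_neg, Complex.norm_exp_ofReal, Real.exp_le_one_iff]
          nlinarith [sq_nonneg (s n i)]
      _ ≤ ∑ i, e / 2 / (|v| + 1) * s n i ^ 2 := by
          refine Finset.sum_le_sum fun i _ => ?_
          have := h4 (y := s n i) (by simpa using (h5 i).trans_lt h6)
          simpa using this
      _ = e / 2 / (|v| + 1) * ∑ i, s n i ^ 2 := by rw [Finset.mul_sum]
      _ ≤ e / 2 / (|v| + 1) * (|v| + 1) := by gcongr
      _ = e / 2 := by field_simp
      _ < e := by linarith
  simpa using h2.add h1

end QuadraticForm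

/-! ### Quadratic forms in Gaussian vectors -/

section Diagonalization

variable {ι : Type*} [Fintype ι] [DecidableEq ι] {S : Matrix ι ι ℝ}

lemma sum_sq_eigenvectorBasis (hS : S.IsHermitian) (i : ι) :
    ∑ k, hS.eigenvectorBasis i k ^ 2 = 1 := by
  have h := hS.eigenvectorBasis.orthonormal.1 i
  rw [EuclideanSpace.norm_eq, Real.sqrt_eq_one] at h
  simpa using h

/-- The eigenvectors of `S` diagonalize the bilinear form of `S`. -/
lemma sum_eigenvectorBasis_mul (hS : S.IsHermitian) (i j : ι) :
    ∑ k, ∑ l, hS.eigenvectorBasis i k * hS.eigenvectorBasis j l * S k l =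
      if i = j then hS.eigenvalues i else 0 := by
  have h1 := hS.mulVec_eigenvectorBasis j
  have h2 (k : ι) : ∑ l, S k l * hS.eigenvectorBasis j l =
      hS.eigenvalues j * hS.eigenvectorBasis j k := by
    simpa [Matrix.mulVec, dotProduct] using congrFun h1 k
  have h3 := orthonormal_iff_ite.1 hS.eigenvectorBasis.orthonormal i j
  have h4 : ∑ k, hS.eigenvectorBasis i k * hS.eigenvectorBasis j k = if i = j then 1 else 0 := by
    rw [← h3]
    simp [PiLp.inner_apply, mul_comm]
  calc _ = ∑ k, hS.eigenvectorBasis i k * ∑ l, S k l * hS.eigenvectorBasis j l := by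
        simp_rw [Finset.mul_sum]
        exact Finset.sum_congr rfl fun k _ => Finset.sum_congr rfl fun l _ => by ring
    _ = hS.eigenvalues j * ∑ k, hS.eigenvectorBasis i k * hS.eigenvectorBasis j k := by
        simp_rw [h2, Finset.mul_sum]
        exact Finset.sum_congr rfl fun k _ => by ring
    _ = _ := by
        rw [h4]
        split_ifs with h <;> simp [h]

/-- The squares of the eigenvalues add up to the square of the Frobenius norm. -/
lemma sum_sq_eigenvalues (hS : S.IsHermitian) :
    ∑ i, hS.eigenvalues i ^ 2 = ∑ k, ∑ l, S k l ^ 2 := by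
  have h2 (i k : ι) : ∑ l, S k l * hS.eigenvectorBasis i l =
      hS.eigenvalues i * hS.eigenvectorBasis i k := by
    simpa [Matrix.mulVec, dotProduct] using congrFun (hS.mulVec_eigenvectorBasis i) k
  have h4 (k : ι) : ∑ i, (∑ l, S k l * hS.eigenvectorBasis i l) ^ 2 = ∑ l, S k l ^ 2 := by
    have := hS.eigenvectorBasis.sum_sq_norm_inner_left (WithLp.toLp 2 (S k))
    rw [EuclideanSpace.real_norm_sq_eq] at this
    simpa [PiLp.inner_apply, mul_comm] using this
  calc ∑ i, hS.eigenvalues i ^ 2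
      = ∑ i, ∑ k, (∑ l, S k l * hS.eigenvectorBasis i l) ^ 2 := by
        simp_rw [h2, mul_pow, ← Finset.mul_sum,
          sum_sq_eigenvectorBasis, mul_one]
    _ = _ := by
        rw [Finset.sum_comm]
        exact Finset.sum_congr rfl fun k _ => h4 k

lemma abs_eigenvalues_le (hS : S.IsHermitian) {M : ℝ}
    (h : ∀ v : ι → ℝ, |∑ k, ∑ l, v k * v l * S k l| ≤ M * ∑ k, v k ^ 2) (i : ι) :
    |hS.eigenvalues i| ≤ M := by
  have h1 := h (hS.eigenvectorBasis i)
  rw [sum_sq_eigenvectorBasis, sum_eigenvectorBasis_mul] at h1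
  simpa using h1

variable {Ω : Type*} [MeasurableSpace Ω] {P : Measure Ω} [IsProbabilityMeasure P]

/-- In the eigenbasis of its covariance matrix, a centred Gaussian vector has independent
components, so that its squared length is a weighted sum of independent `χ²` variables. -/
lemma charFun_map_sum_sq_sub (hS : S.IsHermitian) {Y : ι → Ω → ℝ}
    (hY : HasGaussianLaw (fun ω i => Y i ω) P) (h0 : ∀ i, ∫ ω, Y i ω ∂P = 0)
    (hcov : ∀ k l, ∫ ω, Y k ω * Y l ω ∂P = S k l) (t : ℝ) :
    charFun (P.map fun ω => ∑ k, Y k ω ^ 2 - ∑ k, S k k) t =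
      ∏ i, chiSqCharFun (hS.eigenvalues i * t) := by
  set B := hS.eigenvectorBasis
  set lam := hS.eigenvalues
  -- the coordinates of `Y` in the eigenbasis
  let V : ι → Ω → ℝ := fun i ω => ∑ k, B i k * Y k ω
  have hYL (k : ι) : MemLp (Y k) 2 P := (hY.eval k).memLp_two
  have hVL (i : ι) : MemLp (V i) 2 P :=
    memLp_finsetSum _ fun k _ => (hYL k).const_mul _
  have hVG : HasGaussianLaw (fun ω i => V i ω) P := by
    let L : (ι → ℝ) →L[ℝ] (ι → ℝ) := ContinuousLinearMap.pi fun i =>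
      ∑ k, B i k • ContinuousLinearMap.proj (R := ℝ) k
    have hL : (fun ω i => V i ω) = fun ω => L (fun i => Y i ω) := by
      ext ω i
      simp [L, V]
    rw [hL]
    exact hY.map_fun L
  have hV0 (i : ι) : ∫ ω, V i ω ∂P = 0 := by
    simp only [V]
    rw [integral_finsetSum _ fun k _ => ((hYL k).integrable (by norm_num)).const_mul _]
    simp [integral_const_mul, h0]
  have hVV (i j : ι) : ∫ ω, V i ω * V j ω ∂P = if i = j then lam i else 0 := by
    rw [← sum_eigenvectorBasis_mul hS i j]
    simp only [V, Finset.sum_mul_sum]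
    have hI (k l : ι) : Integrable (fun ω => B i k * Y k ω * (B j l * Y l ω)) P :=
      ((hYL k).const_mul _).integrable_mul ((hYL l).const_mul _)
    rw [integral_finsetSum _ fun k _ => integrable_finsetSum _ fun l _ => hI k l]
    refine Finset.sum_congr rfl fun k _ => ?_
    rw [integral_finsetSum _ fun l _ => hI k l]
    refine Finset.sum_congr rfl fun l _ => ?_
    rw [← hcov, ← integral_const_mul]
    congr with ω
    ring
  have hind : iIndepFun V P := hVG.iIndepFun_of_covariance_eq_zero fun i j hij => by
    rw [covariance_eq_sub (hVL i) (hVL j), hV0, hV0]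
    simpa [hij] using hVV i j
  have hlam (i : ι) : 0 ≤ lam i := by
    have := hVV i i
    rw [if_pos rfl] at this
    rw [← this]
    exact integral_nonneg fun ω => mul_self_nonneg _
  have hVm (i : ι) : AEMeasurable (V i) P := (hVL i).aestronglyMeasurable.aemeasurable
  have hmap (i : ι) : P.map (V i) = (gaussianReal 0 1).map fun z => √(lam i) * z := by
    have h1 : Var[V i; P] = lam i := by
      rw [variance_of_integral_eq_zero (hVm i) (hV0 i)]
      simpa [pow_two] using hVV i i
    rw [(hVG.eval i).map_eq_gaussianReal, hV0, h1, gaussianReal_map_const_mul]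
    congr 1
    · simp
    · ext
      simp [Real.sq_sqrt (hlam i), hlam i]
  have hchar (i : ι) : charFun (P.map fun ω => V i ω ^ 2 - lam i) t =
      chiSqCharFun (lam i * t) := by
    rw [show (fun ω => V i ω ^ 2 - lam i) = (fun x => x ^ 2 - lam i) ∘ V i from rfl,
      ← AEMeasurable.map_map_of_aemeasurable (by fun_prop) (hVm i), hmap,
      Measure.map_map (by fun_prop) (by fun_prop), chiSqCharFun,
      ← charFun_map_mul_comp (by fun_prop)]
    congr 2
    ext z
    simp only [Function.comp_apply, mul_pow, Real.sq_sqrt (hlam i)]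
    ring
  have htr : ∑ k, S k k = ∑ i, lam i := by
    simpa [Matrix.trace] using hS.trace_eq_sum_eigenvalues
  have hsq (ω : Ω) : ∑ k, Y k ω ^ 2 = ∑ i, V i ω ^ 2 := by
    have := B.sum_sq_norm_inner_left (WithLp.toLp 2 fun k => Y k ω)
    rw [EuclideanSpace.real_norm_sq_eq] at this
    simpa [PiLp.inner_apply, mul_comm, V] using this.symm
  have hfin : (fun ω => ∑ k, Y k ω ^ 2 - ∑ k, S k k) =
      fun ω => ∑ i, (V i ω ^ 2 - lam i) := by
    ext ω
    rw [hsq, htr, Finset.sum_sub_distrib]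
  have hind2 : iIndepFun (fun i ω => V i ω ^ 2 - lam i) P :=
    hind.comp (fun i x => x ^ 2 - lam i) fun i => by fun_prop
  rw [hfin, hind2.charFun_map_fun_sum_eq_prod fun i => ((hVm i).pow_const 2).sub_const _,
    Finset.prod_apply]
  exact Finset.prod_congr rfl fun i _ => hchar i

end Diagonalization

/-! ### Toeplitz sections -/

section Toeplitz

open scoped Real

/-- The `d`-th Toeplitz entry `∫_{-π}^{π} g(x) exp (i d x) dx` of the symbol `g`. -/
noncomputable def toeplitzCoeff (g : ℝ → ℝ) (d : ℤ) : ℂ :=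
  ∫ x in (-π)..π, (g x : ℂ) * Complex.exp (Complex.I * (d : ℂ) * (x : ℂ))

variable {g : ℝ → ℝ} {M : ℝ}

lemma norm_exp_I_mul_int_mul (d : ℤ) (x : ℝ) :
    ‖Complex.exp (Complex.I * (d : ℂ) * (x : ℂ))‖ = 1 := by
  rw [Complex.norm_exp]
  simp

lemma intervalIntegrable_mul_exp (hg : Measurable g) (hM : ∀ x ∈ Icc (-π) π, |g x| ≤ M) (d : ℤ) :
    IntervalIntegrable (fun x => (g x : ℂ) * Complex.exp (Complex.I * (d : ℂ) * (x : ℂ)))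
      volume (-π) π := by
  rw [intervalIntegrable_iff_integrableOn_Ioc_of_le (by linarith [Real.pi_pos])]
  refine Measure.integrableOn_of_bounded (M := M) (by simp) (by fun_prop) ?_
  refine (ae_restrict_mem measurableSet_Ioc).mono fun x hx => ?_
  simpa [norm_exp_I_mul_int_mul] using hM x (Ioc_subset_Icc_self hx)

/-- Parseval's identity for the Toeplitz entries. -/
lemma hasSum_sq_toeplitzCoeff (hg : Measurable g) (hM : ∀ x ∈ Icc (-π) π, |g x| ≤ M) :
    HasSum (fun d => ‖toeplitzCoeff g d‖ ^ 2) (2 * π * ∫ x in (-π)..π, g x ^ 2) := by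
  have hlt : -π < π := by linarith [Real.pi_pos]
  have hL2 : MemLp (fun x => (g x : ℂ)) 2 (volume.restrict (Ioc (-π) π)) := by
    refine MemLp.of_bound (by fun_prop) M ?_
    refine (ae_restrict_mem measurableSet_Ioc).mono fun x hx => ?_
    simpa using hM x (Ioc_subset_Icc_self hx)
  have h := hasSum_sq_fourierCoeffOn hlt hL2
  have hc (n : ℤ) : fourierCoeffOn hlt (fun x => (g x : ℂ)) n =
      (1 / (2 * π) : ℝ) * toeplitzCoeff g (-n) := by
    rw [fourierCoeffOn_eq_integral, toeplitzCoeff, Complex.real_smul, sub_neg_eq_add, ← two_mul]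
    congr 1
    refine intervalIntegral.integral_congr fun x _ => ?_
    simp only [smul_eq_mul]
    rw [mul_comm, fourier_coe_apply]
    congr 2
    have : (π : ℂ) ≠ 0 := by exact_mod_cast Real.pi_ne_zero
    push_cast
    field_simp
  have h3 (n : ℤ) : (2 * π) ^ 2 * ‖fourierCoeffOn hlt (fun x => (g x : ℂ)) n‖ ^ 2 =
      ‖toeplitzCoeff g (-n)‖ ^ 2 := by
    have : (2 * π) ≠ 0 := by positivity
    rw [hc, norm_mul, mul_pow, Complex.norm_real, Real.norm_of_nonneg (by positivity)]
    field_simp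
  have h4 := h.mul_left ((2 * π) ^ 2)
  simp_rw [h3] at h4
  have h5 : (2 * π) ^ 2 * ((π - -π)⁻¹ • ∫ x in (-π)..π, ‖(g x : ℂ)‖ ^ 2) =
      2 * π * ∫ x in (-π)..π, g x ^ 2 := by
    have := Real.pi_ne_zero
    simp only [Complex.norm_real, Real.norm_eq_abs, sq_abs, smul_eq_mul]
    rw [← mul_assoc]
    congr 1
    field_simp
    ring
  rw [← (Equiv.neg ℤ).hasSum_iff, ← h5]
  exact h4

/-- The quadratic form of a Toeplitz matrix is the integral of its symbol against the squared
modulus of a trigonometric polynomial. -/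
lemma sum_sum_mul_toeplitzCoeff {ι : Type*} [Fintype ι] (hg : Measurable g)
    (hM : ∀ x ∈ Icc (-π) π, |g x| ≤ M) (v : ι → ℝ) (κ : ι → ℤ) :
    ∑ k, ∑ l, (v k : ℂ) * v l * toeplitzCoeff g (κ k - κ l) =
      ∫ x in (-π)..π, (g x : ℂ) *
        (‖∑ k, (v k : ℂ) * Complex.exp (Complex.I * (κ k : ℂ) * (x : ℂ))‖ ^ 2 : ℝ) := by
  have hI := intervalIntegrable_mul_exp hg hM
  simp only [toeplitzCoeff, ← intervalIntegral.integral_const_mul]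
  simp_rw [← intervalIntegral.integral_finsetSum fun l _ => (hI _).const_mul _]
  rw [← intervalIntegral.integral_finsetSum]
  · refine intervalIntegral.integral_congr fun x _ => ?_
    rw [Complex.ofReal_pow, ← Complex.mul_conj', map_sum, Finset.sum_mul_sum, Finset.mul_sum]
    refine Finset.sum_congr rfl fun k _ => ?_
    rw [Finset.mul_sum]
    refine Finset.sum_congr rfl fun l _ => ?_
    rw [map_mul, Complex.conj_ofReal, ← Complex.exp_conj]
    simp only [map_mul, Complex.conj_I, Complex.conj_ofReal, map_intCast]
    rw [show Complex.I * ((κ k - κ l : ℤ) : ℂ) * (x : ℂ) =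
      Complex.I * κ k * x + -Complex.I * κ l * x by push_cast; ring, Complex.exp_add]
    ring
  · intro k _
    simpa only [Finset.sum_fn] using
      IntervalIntegrable.sum Finset.univ fun l _ => (hI (κ k - κ l)).const_mul ((v k : ℂ) * v l)

lemma toeplitzCoeff_one (d : ℤ) : toeplitzCoeff (fun _ => 1) d =
    if d = 0 then 2 * (π : ℂ) else 0 := by
  rw [toeplitzCoeff]
  split_ifs with h
  · simp [h]
    ring
  · have hd : Complex.I * (d : ℂ) ≠ 0 := mul_ne_zero Complex.I_ne_zero (by exact_mod_cast h)
    simp only [Complex.ofReal_one, one_mul]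
    rw [integral_exp_mul_complex hd]
    refine div_eq_zero_iff.2 (Or.inl ?_)
    rw [sub_eq_zero, Complex.exp_eq_exp_iff_exists_int]
    refine ⟨d, ?_⟩
    push_cast
    ring

/-- The quadratic form of a Toeplitz matrix is bounded by the supremum of its symbol. -/
lemma norm_sum_sum_mul_toeplitzCoeff_le {ι : Type*} [Fintype ι] (hg : Measurable g)
    (hM : ∀ x ∈ Icc (-π) π, |g x| ≤ M) (v : ι → ℝ) {κ : ι → ℤ} (hκ : Function.Injective κ) :
    ‖∑ k, ∑ l, (v k : ℂ) * v l * toeplitzCoeff g (κ k - κ l)‖ ≤ 2 * π * M * ∑ k, v k ^ 2 := by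
  classical
  have hpi : -π ≤ π := by linarith [Real.pi_pos]
  have h1 := sum_sum_mul_toeplitzCoeff (g := fun _ => 1) (M := 1) measurable_const (by simp) v κ
  have h2 : ∫ x in (-π)..π,
      ‖∑ k, (v k : ℂ) * Complex.exp (Complex.I * (κ k : ℂ) * (x : ℂ))‖ ^ 2 =
        2 * π * ∑ k, v k ^ 2 := by
    simp only [toeplitzCoeff_one, sub_eq_zero, hκ.eq_iff, Complex.ofReal_one, one_mul] at h1
    rw [intervalIntegral.integral_ofReal] at h1
    refine Complex.ofReal_injective ?_
    rw [← h1]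
    simp only [mul_ite, mul_zero, Finset.sum_ite_eq, Finset.mem_univ, if_true]
    push_cast
    rw [Finset.mul_sum]
    exact Finset.sum_congr rfl fun k _ => by ring
  rw [sum_sum_mul_toeplitzCoeff hg hM]
  calc _ ≤ ∫ x in (-π)..π,
      M * ‖∑ k, (v k : ℂ) * Complex.exp (Complex.I * (κ k : ℂ) * (x : ℂ))‖ ^ 2 := by
        refine intervalIntegral.norm_integral_le_of_norm_le hpi
          (Eventually.of_forall fun x hx => ?_)
          (Continuous.intervalIntegrable (by fun_prop) _ _)
        rw [norm_mul, Complex.norm_real, Complex.norm_real, Real.norm_eq_abs, Real.norm_of_nonneg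
          (by positivity)]
        gcongr
        exact hM x (Ioc_subset_Icc_self hx)
    _ = _ := by
        rw [intervalIntegral.integral_const_mul, h2]
        ring

lemma sum_sum_sub_le_mul_of_hasSum {F : ℤ → ℝ} {T : ℝ} (hF : ∀ d, 0 ≤ F d) (hT : HasSum F T)
    (n : ℕ) : ∑ k ∈ Finset.Icc 1 n, ∑ l ∈ Finset.Icc 1 n, F ((k : ℤ) - l) ≤ n * T := by
  have h (k : ℕ) : ∑ l ∈ Finset.Icc 1 n, F ((k : ℤ) - l) ≤ T := by
    rw [← Finset.sum_image (g := fun l : ℕ => (k : ℤ) - l) (f := F)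
      (fun a _ b _ hab => by simpa using hab)]
    exact sum_le_hasSum _ (fun i _ => hF i) hT
  simpa using Finset.sum_le_card_nsmul (Finset.Icc 1 n) _ T fun k _ => h k

/-- In rows at distance at least `R` from the boundary, a Toeplitz section contains every entry with
index in `D ⊆ [-R, R]`. -/
lemma mul_sum_le_sum_sum_sub {F : ℤ → ℝ} (hF : ∀ d, 0 ≤ F d) {D : Finset ℤ} {R : ℕ}
    (hD : ∀ d ∈ D, |d| ≤ R) {n : ℕ} (hn : 2 * R ≤ n) :
    ((n : ℝ) - 2 * R) * ∑ d ∈ D, F d ≤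
      ∑ k ∈ Finset.Icc 1 n, ∑ l ∈ Finset.Icc 1 n, F ((k : ℤ) - l) := by
  have h (k : ℕ) (hk : k ∈ Finset.Icc (1 + R) (n - R)) :
      ∑ d ∈ D, F d ≤ ∑ l ∈ Finset.Icc 1 n, F ((k : ℤ) - l) := by
    rw [← Finset.sum_image (g := fun l : ℕ => (k : ℤ) - l) (f := F)
      (fun a _ b _ hab => by simpa using hab)]
    refine Finset.sum_le_sum_of_subset_of_nonneg (fun d hd => ?_) fun i _ _ => hF i
    have h1 := abs_le.1 (hD d hd)
    rw [Finset.mem_Icc] at hk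
    refine Finset.mem_image.2 ⟨((k : ℤ) - d).toNat, ?_, ?_⟩
    · rw [Finset.mem_Icc]
      omega
    · omega
  calc ((n : ℝ) - 2 * R) * ∑ d ∈ D, F d
      = (Finset.Icc (1 + R) (n - R)).card • ∑ d ∈ D, F d := by
        rw [Nat.card_Icc, nsmul_eq_mul, show n - R + 1 - (1 + R) = n - 2 * R by omega,
          Nat.cast_sub hn]
        push_cast
        ring
    _ ≤ ∑ k ∈ Finset.Icc (1 + R) (n - R), ∑ l ∈ Finset.Icc 1 n, F ((k : ℤ) - l) :=
        Finset.card_nsmul_le_sum _ _ _ h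
    _ ≤ _ := Finset.sum_le_sum_of_subset_of_nonneg
        (Finset.Icc_subset_Icc (by omega) (by omega))
        fun k _ _ => Finset.sum_nonneg fun l _ => hF _

/-- Normalized Hilbert–Schmidt norms of Toeplitz sections converge when the entries converge
pointwise and the total masses converge to the mass of the limit. -/
lemma tendsto_sum_sum_sub_div {m : ℕ → ℕ} (hm : Tendsto m atTop atTop) {F : ℕ → ℤ → ℝ}
    {F₀ : ℤ → ℝ} {T : ℕ → ℝ} {T₀ : ℝ} (hF : ∀ j d, 0 ≤ F j d)
    (hlim : ∀ d, Tendsto (fun j => F j d) atTop (𝓝 (F₀ d)))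
    (hT : ∀ᶠ j in atTop, HasSum (F j) (T j)) (hT₀ : HasSum F₀ T₀)
    (hTlim : Tendsto T atTop (𝓝 T₀)) :
    Tendsto (fun j => (∑ k ∈ Finset.Icc 1 (m j), ∑ l ∈ Finset.Icc 1 (m j), F j ((k : ℤ) - l)) /
      (m j : ℝ)) atTop (𝓝 T₀) := by
  have hmR : Tendsto (fun j => (m j : ℝ)) atTop atTop := tendsto_natCast_atTop_atTop.comp hm
  refine tendsto_order.2 ⟨fun r hr => ?_, fun r hr => ?_⟩
  · obtain ⟨D, hD⟩ := ((tendsto_order.1 hT₀).1 r hr).exists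
    obtain ⟨R, hR⟩ : ∃ R : ℕ, ∀ d ∈ D, |d| ≤ R :=
      ⟨D.sup Int.natAbs, fun d hd => by
        rw [Int.abs_eq_natAbs]
        exact_mod_cast Finset.le_sup (f := Int.natAbs) hd⟩
    have h1 : Tendsto (fun j => (1 - 2 * R / (m j : ℝ)) * ∑ d ∈ D, F j d) atTop
        (𝓝 ((1 - 0) * ∑ d ∈ D, F₀ d)) :=
      (tendsto_const_nhds.sub (hmR.const_div_atTop _)).mul (tendsto_finsetSum _ fun d _ => hlim d)
    rw [sub_zero, one_mul] at h1
    filter_upwards [(tendsto_order.1 h1).1 r hD, hm.eventually_ge_atTop (2 * R + 1)] with j h2 h3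
    refine h2.trans_le ?_
    have h4 : (0 : ℝ) < m j := by exact_mod_cast (by omega : 0 < m j)
    rw [le_div_iff₀ h4]
    refine le_trans (le_of_eq ?_) (mul_sum_le_sum_sum_sub (hF j) hR (by omega : 2 * R ≤ m j))
    field_simp
  · filter_upwards [hT, (tendsto_order.1 hTlim).2 r hr, hm.eventually_ge_atTop 1] with j h1 h2 h3
    refine lt_of_le_of_lt ?_ h2
    have h4 : (0 : ℝ) < m j := by exact_mod_cast h3
    rw [div_le_iff₀ h4, mul_comm]
    exact sum_sum_sub_le_mul_of_hasSum (hF j) h1 (m j)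

/-- Boundedly convergent symbols have convergent Toeplitz entries. -/
lemma tendsto_toeplitzCoeff {g : ℕ → ℝ → ℝ} {g₀ : ℝ → ℝ} {M : ℝ}
    (hg : ∀ᶠ j in atTop, Measurable (g j)) (hM : ∀ᶠ j in atTop, ∀ x ∈ Icc (-π) π, |g j x| ≤ M)
    (hlim : ∀ x, Tendsto (fun j => g j x) atTop (𝓝 (g₀ x))) (d : ℤ) :
    Tendsto (fun j => toeplitzCoeff (g j) d) atTop (𝓝 (toeplitzCoeff g₀ d)) := by
  have hπ : -π ≤ π := by linarith [Real.pi_pos]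
  refine intervalIntegral.tendsto_integral_filter_of_dominated_convergence (fun _ => M) ?_ ?_
    (by simp) (Eventually.of_forall fun x _ => ?_)
  · filter_upwards [hg] with j hj
    fun_prop
  · filter_upwards [hM] with j hj
    refine Eventually.of_forall fun x hx => ?_
    rw [uIoc_of_le hπ] at hx
    simpa [norm_exp_I_mul_int_mul] using hj x (Ioc_subset_Icc_self hx)
  · exact ((Complex.continuous_ofReal.tendsto _).comp (hlim x)).mul_const _

/-- With Parseval's identity: the total masses of the squared Toeplitz entries converge. -/
lemma tendsto_integral_sq {g : ℕ → ℝ → ℝ} {g₀ : ℝ → ℝ} {M : ℝ}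
    (hg : ∀ᶠ j in atTop, Measurable (g j)) (hM : ∀ᶠ j in atTop, ∀ x ∈ Icc (-π) π, |g j x| ≤ M)
    (hlim : ∀ x, Tendsto (fun j => g j x) atTop (𝓝 (g₀ x))) :
    Tendsto (fun j => ∫ x in (-π)..π, g j x ^ 2) atTop (𝓝 (∫ x in (-π)..π, g₀ x ^ 2)) := by
  have hπ : -π ≤ π := by linarith [Real.pi_pos]
  refine intervalIntegral.tendsto_integral_filter_of_dominated_convergence (fun _ => M ^ 2) ?_ ?_
    (by simp) (Eventually.of_forall fun x _ => (hlim x).pow 2)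
  · filter_upwards [hg] with j hj
    fun_prop
  · filter_upwards [hM] with j hj
    refine Eventually.of_forall fun x hx => ?_
    rw [uIoc_of_le hπ] at hx
    rw [norm_pow, Real.norm_eq_abs]
    gcongr
    exact hj x (Ioc_subset_Icc_self hx)

end Toeplitz

/-! ### Sums of squares of stationary Gaussian arrays -/

section QuadraticFormCLT

open scoped Real

/-- A central limit theorem, in terms of characteristic functions, for sums of squares of stationary
Gaussian arrays whose symbols converge boundedly. -/
lemma tendsto_charFun_sum_sq {Ω : Type*} [MeasurableSpace Ω] {P : Measure Ω}
    [IsProbabilityMeasure P] {m : ℕ → ℕ} (hm : Tendsto m atTop atTop) {Y : ℕ → ℕ → Ω → ℝ}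
    (hY : ∀ j, HasGaussianLaw (fun ω (k : Finset.Icc 1 (m j)) => Y j k ω) P)
    (h0 : ∀ j k, ∫ ω, Y j k ω ∂P = 0) {g : ℕ → ℝ → ℝ} {g₀ : ℝ → ℝ} {M : ℝ}
    (hcov : ∀ᶠ j in atTop, ∀ k l : ℕ,
      ((∫ ω, Y j k ω * Y j l ω ∂P : ℝ) : ℂ) = toeplitzCoeff (g j) ((k : ℤ) - l))
    (hg : ∀ᶠ j in atTop, Measurable (g j)) (hM : ∀ᶠ j in atTop, ∀ x ∈ Icc (-π) π, |g j x| ≤ M)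
    (hlim : ∀ x, Tendsto (fun j => g j x) atTop (𝓝 (g₀ x))) (hg₀ : Measurable g₀)
    (hM₀ : ∀ x ∈ Icc (-π) π, |g₀ x| ≤ M) (t : ℝ) :
    Tendsto (fun j => charFun (P.map fun ω => (√(m j : ℝ))⁻¹ *
        (∑ k ∈ Finset.Icc 1 (m j), Y j k ω ^ 2 -
          ∑ k ∈ Finset.Icc 1 (m j), ∫ ω, Y j k ω * Y j k ω ∂P)) t) atTop
      (𝓝 (Complex.exp (-(t ^ 2 * (2 * π * ∫ x in (-π)..π, g₀ x ^ 2) : ℝ)))) := by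
  -- the covariance matrix of the `j`-th row
  let S (j : ℕ) : Matrix (Finset.Icc 1 (m j)) (Finset.Icc 1 (m j)) ℝ :=
    fun k l => ∫ ω, Y j k ω * Y j l ω ∂P
  have hS (j : ℕ) : (S j).IsHermitian := by
    refine Matrix.IsHermitian.ext fun k l => ?_
    simp only [S, star_trivial, mul_comm]
  have hchar (j : ℕ) : charFun (P.map fun ω => (√(m j : ℝ))⁻¹ *
        (∑ k ∈ Finset.Icc 1 (m j), Y j k ω ^ 2 -
          ∑ k ∈ Finset.Icc 1 (m j), ∫ ω, Y j k ω * Y j k ω ∂P)) t =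
      ∏ i, chiSqCharFun ((hS j).eigenvalues i * ((√(m j : ℝ))⁻¹ * t)) := by
    have hYm (k : Finset.Icc 1 (m j)) : AEMeasurable (Y j k) P :=
      ((hY j).eval k).aemeasurable
    rw [← charFun_map_sum_sq_sub (hS j) (hY j) (fun i => h0 j i) (fun k l => rfl),
      ← charFun_map_mul_comp (by fun_prop)]
    simp_rw [← Finset.sum_coe_sort (Finset.Icc 1 (m j))]
    rfl
  have hmR : Tendsto (fun j => (m j : ℝ)) atTop atTop := tendsto_natCast_atTop_atTop.comp hm
  simp_rw [hchar]
  refine tendsto_prod_chiSqCharFun _ (fun j => 2 * π * M * ((√(m j : ℝ))⁻¹ * |t|)) ?_ ?_ ?_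
  · have h1 : Tendsto (fun j => (√(m j : ℝ))⁻¹) atTop (𝓝 0) :=
      tendsto_inv_atTop_zero.comp (Real.tendsto_sqrt_atTop.comp hmR)
    simpa using (h1.mul_const |t|).const_mul (2 * π * M)
  -- the eigenvalues are bounded by `2 * π * M`, so that the weights vanish uniformly
  · filter_upwards [hcov, hg, hM] with j h1 h2 h3 i
    rw [abs_mul, abs_mul, abs_of_nonneg (inv_nonneg.2 (Real.sqrt_nonneg _))]
    gcongr
    refine abs_eigenvalues_le (hS j) (fun v => ?_) i
    have h4 := norm_sum_sum_mul_toeplitzCoeff_le h2 h3 v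
      (κ := fun k : Finset.Icc 1 (m j) => ((k : ℕ) : ℤ))
      (fun a b hab => Subtype.ext (Nat.cast_injective hab))
    simp_rw [← h1] at h4
    rw [← Real.norm_eq_abs, ← Complex.norm_real]
    push_cast
    exact h4
  -- the sum of the squared weights is a normalized Hilbert–Schmidt norm
  · have h1 : Tendsto (fun j => (∑ k ∈ Finset.Icc 1 (m j), ∑ l ∈ Finset.Icc 1 (m j),
        ‖toeplitzCoeff (g j) ((k : ℤ) - l)‖ ^ 2) / (m j : ℝ)) atTop
        (𝓝 (2 * π * ∫ x in (-π)..π, g₀ x ^ 2)) := by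
      refine tendsto_sum_sum_sub_div hm (F := fun j d => ‖toeplitzCoeff (g j) d‖ ^ 2)
        (fun j d => by positivity)
        (fun d => ((tendsto_toeplitzCoeff hg hM hlim d).norm).pow 2) ?_
        (hasSum_sq_toeplitzCoeff hg₀ hM₀) ((tendsto_integral_sq hg hM hlim).const_mul _)
      filter_upwards [hg, hM] with j h2 h3
      exact hasSum_sq_toeplitzCoeff h2 h3
    refine (h1.const_mul (t ^ 2)).congr' ?_
    filter_upwards [hcov] with j h2
    have h3 : ∑ k ∈ Finset.Icc 1 (m j), ∑ l ∈ Finset.Icc 1 (m j),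
        ‖toeplitzCoeff (g j) ((k : ℤ) - l)‖ ^ 2 = ∑ i, (hS j).eigenvalues i ^ 2 := by
      rw [sum_sq_eigenvalues, ← Finset.sum_coe_sort]
      refine Finset.sum_congr rfl fun k _ => ?_
      rw [← Finset.sum_coe_sort]
      refine Finset.sum_congr rfl fun l _ => ?_
      rw [← h2, Complex.norm_real, Real.norm_eq_abs, sq_abs]
    rw [h3]
    simp_rw [mul_pow, inv_pow, Real.sq_sqrt (Nat.cast_nonneg (m j)), ← Finset.sum_mul]
    ring

end QuadraticFormCLT

/-! ### Spectral formula for the covariances -/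

section FilterFourier

variable {ψ : ℝ → ℝ}

lemma norm_exp_neg_I_mul (ξ t : ℝ) : ‖Complex.exp (-(Complex.I * (ξ : ℂ) * (t : ℂ)))‖ = 1 := by
  rw [Complex.norm_exp]
  simp

lemma continuous_filterFourier (hψ : Integrable ψ) : Continuous (filterFourier ψ) := by
  refine continuous_of_dominated (bound := fun t => ‖ψ t‖) (fun ξ => ?_) (fun ξ => ?_) hψ.norm ?_
  · exact (by fun_prop : Continuous fun t : ℝ => Complex.exp (-(Complex.I * (ξ : ℂ) * (t : ℂ))))
      |>.aestronglyMeasurable.mul (Complex.continuous_ofReal.comp_aestronglyMeasurable hψ.1)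
  · exact Eventually.of_forall fun t => by
      rw [norm_mul, norm_exp_neg_I_mul, one_mul, Complex.norm_real]
  · exact Eventually.of_forall fun t => by fun_prop

lemma norm_filterFourier_le (ξ : ℝ) : ‖filterFourier ψ ξ‖ ≤ ∫ t, ‖ψ t‖ := by
  refine (norm_integral_le_integral_norm _).trans (le_of_eq ?_)
  congr with t
  rw [norm_mul, norm_exp_neg_I_mul, one_mul, Complex.norm_real]

lemma conj_filterFourier (ξ : ℝ) :
    (starRingEnd ℂ) (filterFourier ψ ξ) =
      ∫ t : ℝ, Complex.exp (Complex.I * (ξ : ℂ) * (t : ℂ)) * (ψ t : ℂ) := by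
  rw [filterFourier, ← integral_conj]
  congr with t
  rw [map_mul, Complex.conj_ofReal, ← Complex.exp_conj]
  simp

/-- The Fourier transform of a rescaled and translated filter. -/
lemma filterFourier_rescale {a : ℝ} (ha : 0 < a) (b ξ : ℝ) :
    filterFourier (fun t => 1 / √a * ψ ((t - b) / a)) ξ =
      √a * Complex.exp (-(Complex.I * ξ * b)) * filterFourier ψ (a * ξ) := by
  have h1 : filterFourier (fun t => 1 / √a * ψ ((t - b) / a)) ξ =
      ∫ t : ℝ, (fun y : ℝ => Complex.exp (-(Complex.I * ξ * (y + b : ℝ))) *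
        ((1 / √a * ψ (y / a) : ℝ) : ℂ)) (t - b) := by
    simp [filterFourier]
  have h2 (y : ℝ) : Complex.exp (-(Complex.I * ξ * (y + b : ℝ))) * ((1 / √a * ψ (y / a) : ℝ) : ℂ) =
      (fun s : ℝ => (1 / √a : ℝ) * Complex.exp (-(Complex.I * ξ * b)) *
        (Complex.exp (-(Complex.I * (a * ξ : ℝ) * s)) * (ψ s : ℂ))) (y / a) := by
    have : (a : ℂ) ≠ 0 := by exact_mod_cast ha.ne'
    rw [show -(Complex.I * ξ * (y + b : ℝ)) = -(Complex.I * ξ * b) +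
      -(Complex.I * (a * ξ : ℝ) * (y / a : ℝ)) by push_cast; field_simp; ring, Complex.exp_add]
    push_cast
    ring
  rw [h1, integral_sub_right_eq_self (fun y : ℝ => Complex.exp (-(Complex.I * ξ * (y + b : ℝ))) *
        ((1 / √a * ψ (y / a) : ℝ) : ℂ)) b]
  simp_rw [h2]
  rw [Measure.integral_comp_div (fun s : ℝ => (1 / √a : ℝ) * Complex.exp (-(Complex.I * ξ * b)) *
        (Complex.exp (-(Complex.I * (a * ξ : ℝ) * s)) * (ψ s : ℂ))) a, integral_const_mul,
    abs_of_pos ha, filterFourier, Complex.real_smul]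
  have h3 : ((a * (1 / √a) : ℝ) : ℂ) = √a := by
    congr 1
    rw [mul_one_div, Real.div_sqrt]
  rw [← mul_assoc, ← mul_assoc, ← Complex.ofReal_mul, h3]

lemma integrable_rescale (hψ : Integrable ψ) {a : ℝ} (ha : a ≠ 0) (b : ℝ) :
    Integrable fun t => 1 / √a * ψ ((t - b) / a) :=
  ((hψ.comp_div ha).comp_sub_right b).const_mul _

end FilterFourier

section Covariance

variable {Ω : Type*} [MeasurableSpace Ω] {P : Measure Ω} [IsProbabilityMeasure P]
  {X : ℝ → Ω → ℝ} {f : ℝ → ℝ} {w v ψ : ℝ → ℝ}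

lemma integral_mul_eq_covariance (hX : IsMeasurableCenteredGaussian P X) (s t : ℝ) :
    ∫ ω, X s ω * X t ω ∂P = cov[X s, X t; P] := by
  rw [covariance_eq_sub (hX.gaussian.hasGaussianLaw_eval s).memLp_two
    (hX.gaussian.hasGaussianLaw_eval t).memLp_two, hX.mean_zero, hX.mean_zero]
  simp

lemma integral_sq_eq (hX : IsMeasurableCenteredGaussian P X) (hf : HasSpectralDensity P X f)
    (t : ℝ) : ∫ ω, X t ω ^ 2 ∂P = ∫ u, f u := by
  have h := hf.covariance_eq t t
  rw [← integral_mul_eq_covariance hX] at h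
  simp only [sub_self, Complex.ofReal_zero, mul_zero, Complex.exp_zero, one_mul] at h
  rw [integral_complex_ofReal] at h
  simpa [pow_two] using Complex.ofReal_injective h

/-- The spectral formula for the covariance of two linear functionals of the process. -/
lemma integral_mul_eq_integral_spectral (hX : IsMeasurableCenteredGaussian P X)
    (hf : HasSpectralDensity P X f) (hw : Integrable w) (hv : Integrable v) :
    ((∫ ω, (∫ s, w s * X s ω) * (∫ t, v t * X t ω) ∂P : ℝ) : ℂ) =
      ∫ u : ℝ, (f u : ℂ) * ((starRingEnd ℂ) (filterFourier w u) * filterFourier v u) := by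
  rw [(integrable_integral_mul_integral hX (fun t => (integral_sq_eq hX hf t).le) hw hv).2,
    ← integral_complex_ofReal]
  have hE (p : ℝ × ℝ) (u : ℝ) :
      ‖Complex.exp (Complex.I * (u : ℂ) * ((p.1 - p.2 : ℝ) : ℂ))‖ = 1 := by
    rw [Complex.norm_exp]
    simp
  have hI0 : Integrable (fun q : (ℝ × ℝ) × ℝ => ((w q.1.1 * v q.1.2 * f q.2 : ℝ) : ℂ))
      ((volume : Measure (ℝ × ℝ)).prod volume) :=
    ((hw.mul_prod hv).mul_prod hf.integrable).ofReal
  have hI : Integrable (fun q : (ℝ × ℝ) × ℝ =>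
      Complex.exp (Complex.I * (q.2 : ℂ) * ((q.1.1 - q.1.2 : ℝ) : ℂ)) *
        ((w q.1.1 * v q.1.2 * f q.2 : ℝ) : ℂ)) ((volume : Measure (ℝ × ℝ)).prod volume) :=
    hI0.bdd_mul (c := 1) (by fun_prop) (Eventually.of_forall fun q => (hE q.1 q.2).le)
  calc ∫ p : ℝ × ℝ, ((w p.1 * v p.2 * ∫ ω, X p.1 ω * X p.2 ω ∂P : ℝ) : ℂ)
      = ∫ p : ℝ × ℝ, ∫ u : ℝ, Complex.exp (Complex.I * (u : ℂ) * ((p.1 - p.2 : ℝ) : ℂ)) *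
        ((w p.1 * v p.2 * f u : ℝ) : ℂ) := by
        congr with p
        rw [integral_mul_eq_covariance hX, Complex.ofReal_mul, hf.covariance_eq,
          ← integral_const_mul]
        congr with u
        push_cast
        ring
    _ = ∫ u : ℝ, ∫ p : ℝ × ℝ, Complex.exp (Complex.I * (u : ℂ) * ((p.1 - p.2 : ℝ) : ℂ)) *
        ((w p.1 * v p.2 * f u : ℝ) : ℂ) := integral_integral_swap hI
    _ = _ := by
        congr with u
        rw [conj_filterFourier, filterFourier, ← integral_prod_mul, ← integral_const_mul,
          ← Measure.volume_eq_prod]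
        congr with p
        rw [show Complex.I * (u : ℂ) * ((p.1 - p.2 : ℝ) : ℂ) = Complex.I * u * p.1 +
          -(Complex.I * u * p.2) by push_cast; ring, Complex.exp_add]
        push_cast
        ring

/-- The covariances of the filter transforms at one scale. -/
lemma integral_rescale_mul_rescale (hX : IsMeasurableCenteredGaussian P X)
    (hf : HasSpectralDensity P X f) (hψ : Integrable ψ) {a : ℝ} (ha : 0 < a) (b b' : ℝ) :
    ((∫ ω, (∫ s, 1 / √a * ψ ((s - b) / a) * X s ω) *
      (∫ t, 1 / √a * ψ ((t - b') / a) * X t ω) ∂P : ℝ) : ℂ) =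
      ∫ η : ℝ, ((f (η / a) * ‖filterFourier ψ η‖ ^ 2 : ℝ) : ℂ) *
        Complex.exp (Complex.I * ((b - b') / a : ℝ) * η) := by
  rw [integral_mul_eq_integral_spectral hX hf (integrable_rescale hψ ha.ne' b)
    (integrable_rescale hψ ha.ne' b')]
  simp_rw [filterFourier_rescale ha]
  have h1 (u : ℝ) : (f u : ℂ) * ((starRingEnd ℂ)
      (√a * Complex.exp (-(Complex.I * u * b)) * filterFourier ψ (a * u)) *
      (√a * Complex.exp (-(Complex.I * u * b')) * filterFourier ψ (a * u))) =
      (fun η : ℝ => (a : ℂ) * (((f (η / a) * ‖filterFourier ψ η‖ ^ 2 : ℝ) : ℂ) *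
        Complex.exp (Complex.I * ((b - b') / a : ℝ) * η))) (a * u) := by
    have ha' : (a : ℂ) ≠ 0 := by exact_mod_cast ha.ne'
    have h2 : ((√a : ℝ) : ℂ) * ((√a : ℝ) : ℂ) = a := by
      rw [← Complex.ofReal_mul, Real.mul_self_sqrt ha.le]
    have h3 := Complex.mul_conj' (filterFourier ψ (a * u))
    have h4 : (starRingEnd ℂ) (Complex.exp (-(Complex.I * u * b))) *
        Complex.exp (-(Complex.I * u * b')) =
        Complex.exp (Complex.I * ((b - b') / a : ℝ) * (a * u : ℝ)) := by
      rw [← Complex.exp_conj, ← Complex.exp_add]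
      congr 1
      simp only [map_neg, map_mul, Complex.conj_I, Complex.conj_ofReal]
      push_cast
      field_simp
      ring
    simp only [mul_div_cancel_left₀ u ha.ne', map_mul, Complex.conj_ofReal]
    rw [← h4]
    push_cast
    rw [← h3]
    linear_combination (f u : ℂ) * (starRingEnd ℂ) (Complex.exp (-(Complex.I * u * b))) *
      Complex.exp (-(Complex.I * u * b')) * (starRingEnd ℂ) (filterFourier ψ (a * u)) *
      filterFourier ψ (a * u) * h2
  simp_rw [h1]
  rw [Measure.integral_comp_mul_left (fun η : ℝ => (a : ℂ) * (((f (η / a) *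
    ‖filterFourier ψ η‖ ^ 2 : ℝ) : ℂ) * Complex.exp (Complex.I * ((b - b') / a : ℝ) * η))),
    integral_const_mul, abs_of_pos (inv_pos.2 ha), Complex.real_smul, ← mul_assoc]
  push_cast
  rw [inv_mul_cancel₀ (by exact_mod_cast ha.ne'), one_mul]

end Covariance

/-! ### Behaviour of the spectral density at the origin, and periodization -/

section Density

/-- An even function that is twice continuously differentiable at the origin is constant there up to
a quadratic error. -/
lemma sub_isBigO_sq_of_even {F : ℝ → ℝ} (hF : ContDiffAt ℝ 2 F 0) (heven : ∀ u, F (-u) = F u) :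
    (fun u => F u - F 0) =O[𝓝 0] fun u => u ^ 2 := by
  have hd0 : deriv F 0 = 0 := by
    have h := deriv_comp_neg F 0
    simp only [heven, neg_zero] at h
    linarith
  have hd1 : DifferentiableAt ℝ (deriv F) 0 := by
    have h : ContDiffAt ℝ 1 (deriv F) 0 := hF.derivWithin (by norm_num)
    exact h.differentiableAt (by norm_num)
  have h1 := hd1.hasDerivAt.isBigO_sub
  simp only [hd0, sub_zero] at h1
  obtain ⟨C, hC⟩ := h1.bound
  have h2 : ∀ᶠ u in 𝓝 (0 : ℝ), DifferentiableAt ℝ F u := by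
    filter_upwards [hF.eventually (by simp)] with u hu
    exact hu.differentiableAt (by norm_num)
  obtain ⟨δ, hδ, hball⟩ := Metric.eventually_nhds_iff.1 (hC.and h2)
  refine Asymptotics.IsBigO.of_bound C (Metric.eventually_nhds_iff.2 ⟨δ, hδ, fun u hu => ?_⟩)
  rw [dist_zero_right] at hu
  have h3 (x : ℝ) (hx : x ∈ Metric.closedBall (0 : ℝ) ‖u‖) : dist x 0 < δ := by
    rw [Metric.mem_closedBall] at hx
    exact hx.trans_lt hu
  have hC0 : 0 ≤ C * ‖u‖ := (norm_nonneg _).trans (hball (h3 u (by simp))).1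
  -- `deriv F` is `O(u)` at `0`, so the mean value inequality on the ball of radius `‖u‖`
  -- gives `O(u²)`
  have h4 := (convex_closedBall (0 : ℝ) ‖u‖).norm_image_sub_le_of_norm_deriv_le (f := F)
    (C := C * ‖u‖) (fun x hx => (hball (h3 x hx)).2) (fun x hx => ?_)
    (Metric.mem_closedBall_self (norm_nonneg u)) (y := u) (by simp)
  · rw [sub_zero] at h4
    rw [norm_pow]
    calc _ ≤ _ := h4
      _ = _ := by ring
  · refine (hball (h3 x hx)).1.trans ?_
    have hx' : ‖x‖ ≤ ‖u‖ := by simpa using hx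
    rcases eq_or_ne u 0 with rfl | hu0
    · have : x = 0 := by simpa using hx'
      simp [this]
    · have : 0 ≤ C := nonneg_of_mul_nonneg_left hC0 (norm_pos_iff.2 hu0)
      gcongr

variable {h : ℝ → ℝ} {s₀ α : ℝ}

lemma ModelAssumption.contDiffAt_cyclicDensity (hm : ModelAssumption h s₀ α) :
    ContDiffAt ℝ 2 (cyclicDensity h s₀ α) 0 := by
  have hs : (0 : ℝ) ^ 2 - s₀ ^ 2 ≠ 0 := by
    have := hm.one_lt
    nlinarith
  refine (hm.contDiff.contDiffAt.of_le (by norm_num)).div ?_ ?_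
  · have hp : ContDiffAt ℝ 2 (fun u : ℝ => u ^ 2 - s₀ ^ 2) 0 := by fun_prop
    exact (hp.abs hs).rpow_const_of_ne (abs_ne_zero.2 hs)
  · exact (Real.rpow_pos_of_pos (abs_pos.2 hs) _).ne'

lemma ModelAssumption.cyclicDensity_zero (hm : ModelAssumption h s₀ α) :
    cyclicDensity h s₀ α 0 = s₀ ^ (-4 * α) := by
  have hs : 0 < s₀ := by linarith [hm.one_lt]
  have h1 : |(0 : ℝ) ^ 2 - s₀ ^ 2| = s₀ ^ (2 : ℝ) := by
    rw [zero_pow two_ne_zero, zero_sub, abs_neg, abs_of_pos (by positivity)]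
    norm_cast
  rw [cyclicDensity, hm.at_zero, h1, ← Real.rpow_mul hs.le, one_div, ← Real.rpow_neg hs.le]
  congr 1
  ring

/-- The spectral density deviates from its value at the origin by a quadratic error. -/
lemma ModelAssumption.cyclicDensity_sub_isBigO (hm : ModelAssumption h s₀ α) :
    (fun u => cyclicDensity h s₀ α u - s₀ ^ (-4 * α)) =O[𝓝 0] fun u => u ^ 2 := by
  rw [← hm.cyclicDensity_zero]
  exact sub_isBigO_sq_of_even hm.contDiffAt_cyclicDensity fun u => by
    simp [cyclicDensity, hm.even]

lemma ModelAssumption.measurable_cyclicDensity (hm : ModelAssumption h s₀ α) :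
    Measurable (cyclicDensity h s₀ α) := by
  have : Measurable h := hm.contDiff.continuous.measurable
  unfold cyclicDensity
  fun_prop

end Density

section Periodization

open scoped Real

/-- The `2π`-periodization of `G`, truncated to the translates by `2πn` with `|n| ≤ N`. -/
noncomputable def periodization (G : ℝ → ℝ) (N : ℕ) (x : ℝ) : ℝ :=
  ∑ k ∈ Finset.range (2 * N + 1), G (x + 2 * π * ((k : ℝ) - N))

/-- The Fourier integral of a compactly supported function at integer frequencies is a Toeplitz
entry of its periodization. -/
lemma integral_mul_exp_eq_toeplitzCoeff {G : ℝ → ℝ} (hG : Integrable G) {N : ℕ}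
    (hsupp : ∀ x, (2 * N + 1) * π ≤ |x| → G x = 0) (d : ℤ) :
    ∫ x : ℝ, (G x : ℂ) * Complex.exp (Complex.I * (d : ℂ) * (x : ℂ)) =
      toeplitzCoeff (periodization G N) d := by
  set F : ℝ → ℂ := fun x => (G x : ℂ) * Complex.exp (Complex.I * (d : ℂ) * (x : ℂ))
  have hF : Integrable F :=
    hG.ofReal.mul_bdd (c := 1) (by fun_prop)
      (Eventually.of_forall fun x => (norm_exp_I_mul_int_mul d x).le)
  -- cut `[-(2N+1)π, (2N+1)π]`, which contains the support of `G`, into `2N+1` periods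
  let b (k : ℕ) : ℝ := -π + 2 * π * ((k : ℝ) - N)
  have h1 : ∑ k ∈ Finset.range (2 * N + 1), ∫ x in b k..b (k + 1), F x =
      ∫ x in b 0..b (2 * N + 1), F x :=
    intervalIntegral.sum_integral_adjacent_intervals fun k _ => hF.intervalIntegrable
  have h2 : ∫ x in b 0..b (2 * N + 1), F x = ∫ x, F x := by
    refine intervalIntegral.integral_eq_integral_of_support_subset fun x hx => ?_
    have h3 : G x ≠ 0 := fun h => hx (by simp [F, h])
    have h4 : |x| < (2 * N + 1) * π := by
      by_contra hcon
      exact h3 (hsupp x (not_lt.1 hcon))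
    rw [abs_lt] at h4
    simp only [b]
    push_cast
    constructor <;> nlinarith
  have h5 (k : ℕ) : ∫ x in b k..b (k + 1), F x = ∫ x in (-π)..π,
      (G (x + 2 * π * ((k : ℝ) - N)) : ℂ) * Complex.exp (Complex.I * (d : ℂ) * (x : ℂ)) := by
    have h6 : (∫ x in (-π)..π, F (x + 2 * π * ((k : ℝ) - N))) = ∫ x in b k..b (k + 1), F x := by
      rw [intervalIntegral.integral_comp_add_right]
      congr 1
      simp only [b]
      push_cast
      ring
    rw [← h6]
    refine intervalIntegral.integral_congr fun x _ => ?_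
    simp only [F]
    congr 1
    rw [Complex.exp_eq_exp_iff_exists_int]
    refine ⟨d * (k - N), ?_⟩
    push_cast
    ring
  rw [← h2, ← h1, toeplitzCoeff]
  simp only [h5, periodization, Complex.ofReal_sum, Finset.sum_mul]
  rw [intervalIntegral.integral_finsetSum]
  intro k _
  have h7 : Integrable fun x => (G (x + 2 * π * ((k : ℝ) - N)) : ℂ) *
      Complex.exp (Complex.I * (d : ℂ) * (x : ℂ)) :=
    (hG.comp_add_right _).ofReal.mul_bdd (c := 1) (by fun_prop)
      (Eventually.of_forall fun x => (norm_exp_I_mul_int_mul d x).le)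
  exact h7.intervalIntegrable

end Periodization

/-! ### Symbols of the covariance matrices -/

section Symbols

open scoped Real

variable {ψ f : ℝ → ℝ} {A a θ c K C : ℝ} {N : ℕ}

lemma FilterAssumption.filterFourier_eq_zero (hψ : FilterAssumption ψ A) {ξ : ℝ} (hξ : A < |ξ|) :
    filterFourier ψ ξ = 0 := by
  by_contra h
  have := hψ.support (subset_tsupport _ h)
  rw [mem_Icc, ← abs_le] at this
  linarith

lemma FilterAssumption.integrable_norm_sq (hψ : FilterAssumption ψ A) :
    Integrable fun η => ‖filterFourier ψ η‖ ^ 2 := by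
  refine Continuous.integrable_of_hasCompactSupport
    ((continuous_filterFourier hψ.integrable).norm.pow 2) ?_
  refine HasCompactSupport.intro (K := Icc (-A) A) isCompact_Icc fun x hx => ?_
  rw [hψ.filterFourier_eq_zero (by rwa [mem_Icc, ← abs_le, not_le] at hx)]
  simp

/-- The spectral density of the filter transforms at scale `a`. -/
noncomputable def scaleDensity (f ψ : ℝ → ℝ) (a η : ℝ) : ℝ :=
  f (η / a) * ‖filterFourier ψ η‖ ^ 2

lemma abs_scaleDensity_le (hψ : FilterAssumption ψ A) (hC : ∀ η, |η| ≤ A → |f (η / a)| ≤ C)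
    (η : ℝ) : |scaleDensity f ψ a η| ≤ C * ‖filterFourier ψ η‖ ^ 2 := by
  rw [scaleDensity, abs_mul, abs_of_nonneg (sq_nonneg ‖filterFourier ψ η‖)]
  rcases le_or_gt |η| A with h | h
  · gcongr
    exact hC η h
  · simp [hψ.filterFourier_eq_zero h]

lemma measurable_scaleDensity (hψ : FilterAssumption ψ A) (hf : Measurable f) :
    Measurable (scaleDensity f ψ a) := by
  have := (continuous_filterFourier hψ.integrable).measurable
  unfold scaleDensity
  fun_prop

lemma integrable_scaleDensity (hψ : FilterAssumption ψ A) (hf : Measurable f)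
    (hC : ∀ η, |η| ≤ A → |f (η / a)| ≤ C) : Integrable (scaleDensity f ψ a) :=
  (hψ.integrable_norm_sq.const_mul C).mono' (measurable_scaleDensity hψ hf).aestronglyMeasurable
    (Eventually.of_forall fun η => abs_scaleDensity_le hψ hC η)

/-- The symbol of the Toeplitz covariance matrix at scale `a` and relative spacing `θ`. -/
noncomputable def scaleSymbol (f ψ : ℝ → ℝ) (N : ℕ) (a θ : ℝ) : ℝ → ℝ :=
  periodization (fun x => θ⁻¹ * scaleDensity f ψ a (x * θ⁻¹)) N

/-- The limit of the symbols `scaleSymbol f ψ N a θ` as `a → ∞` and `θ → 1 / c`. -/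
noncomputable def limitSymbol (ψ : ℝ → ℝ) (N : ℕ) (K c : ℝ) : ℝ → ℝ :=
  periodization (fun x => c * (K * ‖filterFourier ψ (x * c)‖ ^ 2)) N

/-- The substitution `x = θη` and periodization turn the covariances at scale `a` into Toeplitz
entries. The condition on `N` says that the truncated periodization loses nothing. -/
lemma toeplitzCoeff_scaleSymbol (hψ : FilterAssumption ψ A) (hf : Measurable f)
    (hC : ∀ η, |η| ≤ A → |f (η / a)| ≤ C) (hθ : 0 < θ) (hN : A * θ < (2 * N + 1) * π) (d : ℤ) :
    ∫ η : ℝ, (scaleDensity f ψ a η : ℂ) * Complex.exp (Complex.I * (θ * d : ℝ) * η) =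
      toeplitzCoeff (scaleSymbol f ψ N a θ) d := by
  have hI : Integrable fun x => θ⁻¹ * scaleDensity f ψ a (x * θ⁻¹) :=
    ((integrable_scaleDensity hψ hf hC).comp_mul_right' (inv_ne_zero hθ.ne')).const_mul _
  rw [scaleSymbol, ← integral_mul_exp_eq_toeplitzCoeff hI]
  · have hθ' : (θ : ℂ) ≠ 0 := by exact_mod_cast hθ.ne'
    have h1 (x : ℝ) : ((θ⁻¹ * scaleDensity f ψ a (x * θ⁻¹) : ℝ) : ℂ) *
        Complex.exp (Complex.I * (d : ℂ) * (x : ℂ)) =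
        (fun η : ℝ => ((θ⁻¹ : ℝ) : ℂ) * ((scaleDensity f ψ a η : ℂ) *
          Complex.exp (Complex.I * (θ * d : ℝ) * η))) (x * θ⁻¹) := by
      have h2 : Complex.I * (d : ℂ) * (x : ℂ) =
          Complex.I * (θ * d : ℝ) * ((x * θ⁻¹ : ℝ) : ℂ) := by
        push_cast
        field_simp
      rw [h2]
      push_cast
      ring
    simp_rw [h1]
    rw [Measure.integral_comp_mul_right (fun η : ℝ => ((θ⁻¹ : ℝ) : ℂ) *
      ((scaleDensity f ψ a η : ℂ) * Complex.exp (Complex.I * (θ * d : ℝ) * η))), inv_inv,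
      abs_of_pos hθ, integral_const_mul, Complex.real_smul, ← mul_assoc, ← Complex.ofReal_mul,
      mul_inv_cancel₀ hθ.ne', Complex.ofReal_one, one_mul]
  · intro x hx
    have h3 : A < |x * θ⁻¹| := by
      rw [abs_mul, abs_of_pos (inv_pos.2 hθ), ← div_eq_mul_inv, lt_div_iff₀ hθ]
      linarith
    simp [scaleDensity, hψ.filterFourier_eq_zero h3]

lemma measurable_periodization {G : ℝ → ℝ} (hG : Measurable G) :
    Measurable (periodization G N) := by
  unfold periodization
  fun_prop

lemma measurable_scaleSymbol (hψ : FilterAssumption ψ A) (hf : Measurable f) :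
    Measurable (scaleSymbol f ψ N a θ) := by
  have := measurable_scaleDensity (a := a) hψ hf
  exact measurable_periodization (by fun_prop)

lemma measurable_limitSymbol (hψ : FilterAssumption ψ A) : Measurable (limitSymbol ψ N K c) := by
  have := (continuous_filterFourier hψ.integrable).measurable
  exact measurable_periodization (by fun_prop)

lemma abs_scaleSymbol_le (hψ : FilterAssumption ψ A) (hC : ∀ η, |η| ≤ A → |f (η / a)| ≤ C)
    (hC0 : 0 ≤ C) {B : ℝ} (hθ : 0 < θ) (hB : θ⁻¹ ≤ B) (x : ℝ) :
    |scaleSymbol f ψ N a θ x| ≤ (2 * N + 1 : ℕ) * (B * (C * (∫ t, ‖ψ t‖) ^ 2)) := by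
  rw [scaleSymbol, periodization]
  refine (Finset.abs_sum_le_sum_abs _ _).trans ?_
  refine (Finset.sum_le_card_nsmul _ _ (B * (C * (∫ t, ‖ψ t‖) ^ 2)) fun k _ => ?_).trans
    (le_of_eq (by simp))
  rw [abs_mul, abs_of_pos (inv_pos.2 hθ)]
  have hθi := inv_pos.2 hθ
  gcongr
  · exact hθi.le.trans hB
  · refine (abs_scaleDensity_le hψ hC _).trans ?_
    gcongr
    exact norm_filterFourier_le _

lemma tendsto_scaleSymbol (hψ : FilterAssumption ψ A) {a θ : ℕ → ℝ} (ha : Tendsto a atTop atTop)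
    (hθ : Tendsto (fun j => (θ j)⁻¹) atTop (𝓝 c)) (hf : Tendsto f (𝓝 0) (𝓝 K)) (x : ℝ) :
    Tendsto (fun j => scaleSymbol f ψ N (a j) (θ j) x) atTop (𝓝 (limitSymbol ψ N K c x)) := by
  simp only [scaleSymbol, limitSymbol, periodization]
  refine tendsto_finsetSum _ fun k _ => ?_
  have h1 : Tendsto (fun j => (x + 2 * π * ((k : ℝ) - N)) * (θ j)⁻¹) atTop
      (𝓝 ((x + 2 * π * ((k : ℝ) - N)) * c)) := hθ.const_mul _
  refine hθ.mul (Tendsto.mul (hf.comp ?_) ?_)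
  · exact h1.div_atTop ha
  · exact (((continuous_filterFourier hψ.integrable).norm.pow 2).tendsto _).comp h1

/-- The asymptotic variance in terms of the limiting symbol. -/
lemma asymptoticVariance_eq (hψ : FilterAssumption ψ A) {s₀ α : ℝ} (hs : 0 < s₀) (hc : 0 < c)
    (hN : A < c * ((2 * N + 1) * π)) :
    asymptoticVariance ψ s₀ α c =
      4 * π * ∫ x in (-π)..π, limitSymbol ψ N (s₀ ^ (-4 * α)) c x ^ 2 := by
  have hπ := Real.pi_pos
  have hK : s₀ ^ (-8 * α) = (s₀ ^ (-4 * α)) ^ 2 := by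
    rw [← Real.rpow_mul_natCast hs.le]
    congr 1
    push_cast
    ring
  have h1 (x : ℝ) (hx : x ∈ uIcc (-π) π) :
      limitSymbol ψ N (s₀ ^ (-4 * α)) c x ^ 2 = c ^ 2 * (s₀ ^ (-4 * α)) ^ 2 *
        |∑' n : ℤ, ‖filterFourier ψ (c * x + 2 * (n : ℝ) * c * π)‖ ^ 2| ^ 2 := by
    rw [uIcc_of_le (by linarith), mem_Icc] at hx
    -- the translates that the truncation leaves out vanish on `[-π, π]`
    have h2 : ∑' n : ℤ, ‖filterFourier ψ (c * x + 2 * (n : ℝ) * c * π)‖ ^ 2 =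
        ∑ n ∈ (Finset.range (2 * N + 1)).image fun k : ℕ => (k : ℤ) - N,
          ‖filterFourier ψ (c * x + 2 * (n : ℝ) * c * π)‖ ^ 2 := by
      refine tsum_eq_sum fun n hn => ?_
      have h3 : (n : ℝ) ≤ -(N + 1) ∨ (N + 1 : ℝ) ≤ n := by
        by_contra! hcon
        obtain ⟨h4, h5⟩ := hcon
        have h4' : -((N : ℤ) + 1) < n := by exact_mod_cast h4
        have h5' : n < (N : ℤ) + 1 := by exact_mod_cast h5
        refine hn (Finset.mem_image.2 ⟨(n + N).toNat, ?_, ?_⟩)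
        · rw [Finset.mem_range]
          omega
        · omega
      have h6 : A < |c * x + 2 * (n : ℝ) * c * π| := by
        rw [show c * x + 2 * (n : ℝ) * c * π = c * (x + 2 * n * π) by ring, abs_mul,
          abs_of_pos hc]
        refine hN.trans_le ?_
        gcongr
        rcases h3 with h3 | h3
        · rw [le_abs]
          right
          nlinarith
        · rw [le_abs]
          left
          nlinarith
      simp [hψ.filterFourier_eq_zero h6]
    rw [h2, sq_abs, Finset.sum_image (fun a _ b _ hab => by simpa using hab), limitSymbol,
      periodization, ← mul_pow c, ← mul_pow, Finset.mul_sum]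
    congr 1
    refine Finset.sum_congr rfl fun k _ => ?_
    rw [show (x + 2 * π * ((k : ℝ) - N)) * c = c * x + 2 * (((k : ℤ) - N : ℤ) : ℝ) * c * π by
      push_cast; ring]
    ring
  rw [asymptoticVariance, intervalIntegral.integral_congr h1, intervalIntegral.integral_const_mul]
  have h7 := intervalIntegral.mul_integral_comp_mul_left (a := -π) (b := π) (c := c)
    (f := fun η => |∑' n : ℤ, ‖filterFourier ψ (η + 2 * (n : ℝ) * c * π)‖ ^ 2| ^ 2)
  rw [mul_neg] at h7
  rw [← h7, hK]
  ring

/-- The bias of the averaged statistic is of order `a⁻²`, hence negligible after scaling. -/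
lemma tendsto_bias (hψ : FilterAssumption ψ A) (hfm : Measurable f)
    (hf : (fun u => f u - K) =O[𝓝 0] fun u => u ^ 2) {a : ℕ → ℝ} {m : ℕ → ℕ}
    (ha0 : ∀ j, 0 < a j) (ha : Tendsto a atTop atTop)
    (hma : Tendsto (fun j => (m j : ℝ) * a j ^ (-4 : ℤ)) atTop (𝓝 0)) :
    Tendsto (fun j => √(m j : ℝ) * ((∫ η, scaleDensity f ψ (a j) η) -
      K * ∫ η, ‖filterFourier ψ η‖ ^ 2)) atTop (𝓝 0) := by
  obtain ⟨C, hC⟩ := hf.bound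
  obtain ⟨δ, hδ, hball⟩ := Metric.eventually_nhds_iff.1 hC
  have hA := hψ.pos
  set J := ∫ η, ‖filterFourier ψ η‖ ^ 2
  have hlim : Tendsto (fun j => √((m j : ℝ) * a j ^ (-4 : ℤ)) * (|C| * A ^ 2 * J)) atTop (𝓝 0) := by
    simpa using ((Real.continuous_sqrt.tendsto _).comp hma).mul_const (|C| * A ^ 2 * J)
  refine squeeze_zero_norm' ?_ hlim
  filter_upwards [ha.eventually_gt_atTop (A / δ)] with j hj
  have haj := ha0 j
  have hsmall (η : ℝ) (hη : |η| ≤ A) : |f (η / a j) - K| ≤ |C| * A ^ 2 * (a j)⁻¹ ^ 2 := by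
    have h1 : dist (η / a j) 0 < δ := by
      rw [dist_zero_right, Real.norm_eq_abs, abs_div, abs_of_pos haj, div_lt_iff₀ haj]
      rw [div_lt_iff₀ hδ] at hj
      linarith
    have h2 := hball h1
    rw [Real.norm_eq_abs, Real.norm_of_nonneg (sq_nonneg (η / a j))] at h2
    calc _ ≤ _ := h2
      _ ≤ |C| * (η / a j) ^ 2 := by gcongr; exact le_abs_self C
      _ = |C| * (|η| ^ 2 * (a j)⁻¹ ^ 2) := by rw [sq_abs]; ring
      _ ≤ |C| * (A ^ 2 * (a j)⁻¹ ^ 2) := by gcongr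
      _ = _ := by ring
  have hbdd (η : ℝ) (hη : |η| ≤ A) : |f (η / a j)| ≤ |C| * A ^ 2 * (a j)⁻¹ ^ 2 + |K| := by
    have := abs_sub_abs_le_abs_sub (f (η / a j)) K
    linarith [hsmall η hη]
  have hI := integrable_scaleDensity hψ hfm hbdd
  rw [← integral_const_mul, ← integral_sub hI (hψ.integrable_norm_sq.const_mul K), norm_mul,
    Real.norm_of_nonneg (Real.sqrt_nonneg _), Real.sqrt_mul (Nat.cast_nonneg _), mul_assoc]
  have hsq : √(a j ^ (-4 : ℤ)) = (a j)⁻¹ ^ 2 := by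
    rw [show a j ^ (-4 : ℤ) = ((a j)⁻¹ ^ 2) ^ 2 by
      rw [zpow_neg, ← pow_mul, inv_pow]; norm_cast, Real.sqrt_sq (by positivity)]
  rw [hsq]
  gcongr
  calc ‖∫ η, (scaleDensity f ψ (a j) η - K * ‖filterFourier ψ η‖ ^ 2)‖
      ≤ ∫ η, |C| * A ^ 2 * (a j)⁻¹ ^ 2 * ‖filterFourier ψ η‖ ^ 2 := by
        refine norm_integral_le_of_norm_le (hψ.integrable_norm_sq.const_mul _)
          (Eventually.of_forall fun η => ?_)
        rw [scaleDensity, ← sub_mul, norm_mul, Real.norm_eq_abs,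
          Real.norm_of_nonneg (sq_nonneg ‖filterFourier ψ η‖)]
        rcases le_or_gt |η| A with h | h
        · gcongr
          exact hsmall η h
        · simp [hψ.filterFourier_eq_zero h]
    _ = _ := by
        rw [integral_const_mul]
        ring

end Symbols

/-! ### The filter transforms -/

section FilterTransform

variable {Ω : Type*} {X : ℝ → Ω → ℝ} {f ψ : ℝ → ℝ} {a : ℕ → ℝ} {b : ℕ → ℤ → ℝ}

lemma filterTransform_eq_integral (j : ℕ) (k : ℤ) :
    filterTransform X ψ a b j k =
      fun ω => ∫ t : ℝ, 1 / √(a j) * ψ ((t - b j k) / a j) * X t ω := by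
  ext ω
  rw [filterTransform, ← integral_const_mul]
  simp only [mul_assoc]

variable [MeasurableSpace Ω] {P : Measure Ω} [IsProbabilityMeasure P]

lemma hasGaussianLaw_filterTransform (hX : IsMeasurableCenteredGaussian P X)
    (hf : HasSpectralDensity P X f) (hψ : Integrable ψ) (ha : ∀ j, 0 < a j) (j : ℕ)
    {ι : Type*} [Fintype ι] (κ : ι → ℤ) :
    HasGaussianLaw (fun ω i => filterTransform X ψ a b j (κ i) ω) P := by
  simp only [filterTransform_eq_integral]
  exact hasGaussianLaw_pi_of_mem_gaussianSpace hX.gaussian hX.mean_zero _ fun i =>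
    integral_mul_mem_gaussianSpace hX (fun t => (integral_sq_eq hX hf t).le)
      (integrable_rescale hψ (ha j).ne' _)

lemma integral_filterTransform (hX : IsMeasurableCenteredGaussian P X)
    (hf : HasSpectralDensity P X f) (hψ : Integrable ψ) (ha : ∀ j, 0 < a j) (j : ℕ) (k : ℤ) :
    ∫ ω, filterTransform X ψ a b j k ω ∂P = 0 := by
  rw [filterTransform_eq_integral]
  exact integral_eq_zero_of_mem_gaussianSpace hX.gaussian hX.mean_zero _ <|
    integral_mul_mem_gaussianSpace hX (fun t => (integral_sq_eq hX hf t).le)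
      (integrable_rescale hψ (ha j).ne' _)

/-- The filter transforms at one scale form a stationary sequence with spectral density
`scaleDensity f ψ (a j)`. -/
lemma integral_filterTransform_mul (hX : IsMeasurableCenteredGaussian P X)
    (hf : HasSpectralDensity P X f) (hψ : Integrable ψ) (ha : ∀ j, 0 < a j) {γ : ℕ → ℝ}
    (hb : ∀ (j : ℕ) (k l : ℤ), b j k - b j l = γ j * ((k : ℝ) - (l : ℝ))) (j : ℕ) (k l : ℤ) :
    ((∫ ω, filterTransform X ψ a b j k ω * filterTransform X ψ a b j l ω ∂P : ℝ) : ℂ) =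
      ∫ η : ℝ, (scaleDensity f ψ (a j) η : ℂ) *
        Complex.exp (Complex.I * (γ j / a j * (k - l : ℤ) : ℝ) * η) := by
  simp only [filterTransform_eq_integral]
  rw [integral_rescale_mul_rescale hX hf hψ (ha j), hb]
  simp only [scaleDensity]
  congr with η
  congr 3
  push_cast
  ring

lemma integral_filterTransform_mul_self (hX : IsMeasurableCenteredGaussian P X)
    (hf : HasSpectralDensity P X f) (hψ : Integrable ψ) (ha : ∀ j, 0 < a j) {γ : ℕ → ℝ}
    (hb : ∀ (j : ℕ) (k l : ℤ), b j k - b j l = γ j * ((k : ℝ) - (l : ℝ))) (j : ℕ) (k : ℤ) :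
    ∫ ω, filterTransform X ψ a b j k ω * filterTransform X ψ a b j k ω ∂P =
      ∫ η : ℝ, scaleDensity f ψ (a j) η := by
  have h := integral_filterTransform_mul hX hf hψ ha hb j k k
  simp only [sub_self, Int.cast_zero, mul_zero, Complex.ofReal_zero, zero_mul, Complex.exp_zero,
    mul_one] at h
  rw [integral_complex_ofReal] at h
  exact Complex.ofReal_injective h

end FilterTransform
end CyclicLongMemory

open CyclicLongMemory in
theorem mainTheorem4 {Ω : Type*} [MeasurableSpace Ω] (P : Measure Ω) [IsProbabilityMeasure P]
    (X : ℝ → Ω → ℝ) (h : ℝ → ℝ) (s₀ α : ℝ) (ψ : ℝ → ℝ) (A : ℝ)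
    (a : ℕ → ℝ) (m : ℕ → ℕ) (b : ℕ → ℤ → ℝ) (γ : ℕ → ℝ) (c : ℝ)
    (hX : CyclicLongMemory.IsMeasurableCenteredGaussian P X)
    (hmodel : CyclicLongMemory.ModelAssumption h s₀ α)
    (hspec : CyclicLongMemory.HasSpectralDensity P X (CyclicLongMemory.cyclicDensity h s₀ α))
    (hψ : CyclicLongMemory.FilterAssumption ψ A)
    (hscale : CyclicLongMemory.ScaleAssumption a m)
    (hshift : CyclicLongMemory.ShiftAssumption a m b γ c)
    (hma : Tendsto (fun j => (m j : ℝ) * a j ^ (-4 : ℤ)) atTop (𝓝 0)) :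
    TendstoInDistribution
      (fun (j : ℕ) (ω : Ω) => √(m j : ℝ) *
        (CyclicLongMemory.meanSquare X ψ a b m j ω -
          s₀ ^ (-4 * α) * ∫ η : ℝ, ‖CyclicLongMemory.filterFourier ψ η‖ ^ 2))
      atTop (id : ℝ → ℝ) (fun _ => P)
      (gaussianReal 0 (CyclicLongMemory.asymptoticVariance ψ s₀ α c).toNNReal) := by
  have hs : 0 < s₀ := by linarith [hmodel.one_lt]
  have hc := hshift.c_pos
  have hπ := Real.pi_pos
  have hapos := hscale.a_pos
  set f := cyclicDensity h s₀ α
  set K := s₀ ^ (-4 * α)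
  have hf0 : Tendsto f (𝓝 0) (𝓝 K) := by
    have := hmodel.contDiffAt_cyclicDensity.continuousAt.tendsto
    rwa [hmodel.cyclicDensity_zero] at this
  have hfm : Measurable f := hmodel.measurable_cyclicDensity
  -- so many translates cover the support of `x ↦ ψ̂ (c x)`, and eventually that of
  -- `x ↦ ψ̂ (x / θ_j)`
  obtain ⟨N, hN⟩ := exists_nat_gt (A / c)
  have hNπ : A / c < (2 * N + 1) * Real.pi := by
    have : (1 : ℝ) ≤ Real.pi := by linarith [Real.pi_gt_three]
    have hN0 : (0 : ℝ) ≤ N := Nat.cast_nonneg N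
    nlinarith
  have hθ : Tendsto (fun j => (γ j / a j)⁻¹) atTop (𝓝 c) := by
    simpa only [inv_div] using hshift.ratio_tendsto
  have hθ' : Tendsto (fun j => γ j / a j) atTop (𝓝 c⁻¹) := by
    simpa only [inv_inv] using hθ.inv₀ hc.ne'
  have hθpos (j : ℕ) : 0 < γ j / a j := div_pos (hshift.gamma_pos j) (hapos j)
  have hθN : ∀ᶠ j in atTop, A * (γ j / a j) < (2 * N + 1) * Real.pi :=
    (tendsto_order.1 (hθ'.const_mul A)).2 _ (by rwa [← div_eq_mul_inv])
  -- at large scales the support of `ψ̂` only sees frequencies away from the poles of `f`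
  have hbdd : ∀ᶠ j in atTop, ∀ η, |η| ≤ A → |f (η / a j)| ≤ |K| + 1 := by
    have h1 : ∀ᶠ u in 𝓝 0, |f u| < |K| + 1 :=
      (tendsto_order.1 hf0.abs).2 _ (by linarith)
    obtain ⟨δ, hδ, hball⟩ := Metric.eventually_nhds_iff.1 h1
    filter_upwards [hscale.a_tendsto.eventually_gt_atTop (A / δ)] with j hj η hη
    refine (hball ?_).le
    rw [dist_zero_right, Real.norm_eq_abs, abs_div, abs_of_pos (hapos j), div_lt_iff₀ (hapos j)]
    rw [div_lt_iff₀ hδ] at hj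
    linarith
  have hlim : ∀ x, Tendsto (fun j => scaleSymbol f ψ N (a j) (γ j / a j) x) atTop
      (𝓝 (limitSymbol ψ N K c x)) := tendsto_scaleSymbol hψ hscale.a_tendsto hθ hf0
  set M := (2 * N + 1 : ℕ) * ((c + 1) * ((|K| + 1) * (∫ t, ‖ψ t‖) ^ 2))
  have hM : ∀ᶠ j in atTop, ∀ x, |scaleSymbol f ψ N (a j) (γ j / a j) x| ≤ M := by
    filter_upwards [hbdd, (tendsto_order.1 hθ).2 (c + 1) (by linarith)] with j h1 h2 x
    exact abs_scaleSymbol_le hψ h1 (by positivity) (hθpos j) h2.le x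
  have hM₀ (x : ℝ) : |limitSymbol ψ N K c x| ≤ M :=
    le_of_tendsto (hlim x).abs (hM.mono fun j hj => hj x)
  let Y (j k : ℕ) : Ω → ℝ := filterTransform X ψ a b j k
  have hYm (j k : ℕ) : AEMeasurable (Y j k) P :=
    ((hasGaussianLaw_filterTransform hX hspec hψ.integrable hapos j
      (fun _ : Unit => (k : ℤ))).eval ()).aemeasurable
  have hYY (j k : ℕ) : ∫ ω, Y j k ω * Y j k ω ∂P = ∫ η, scaleDensity f ψ (a j) η :=
    integral_filterTransform_mul_self hX hspec hψ.integrable hapos hshift.spacing j k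
  have hclt (t : ℝ) := tendsto_charFun_sum_sq hscale.m_tendsto (Y := Y)
    (fun j => hasGaussianLaw_filterTransform hX hspec hψ.integrable hapos j
      fun k : Finset.Icc 1 (m j) => ((k : ℕ) : ℤ))
    (fun j k => integral_filterTransform hX hspec hψ.integrable hapos j k)
    (g := fun j => scaleSymbol f ψ N (a j) (γ j / a j)) (g₀ := limitSymbol ψ N K c) (M := M)
    (by
      filter_upwards [hbdd, hθN] with j h1 h2 k l
      rw [← toeplitzCoeff_scaleSymbol hψ hfm h1 (hθpos j) h2]
      exact integral_filterTransform_mul hX hspec hψ.integrable hapos hshift.spacing j k l)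
    (Eventually.of_forall fun j => measurable_scaleSymbol hψ hfm)
    (hM.mono fun j hj x _ => hj x) hlim (measurable_limitSymbol hψ) (fun x _ => hM₀ x) t
  have hbias := tendsto_bias hψ hfm hmodel.cyclicDensity_sub_isBigO hapos hscale.a_tendsto hma
  set β : ℕ → ℝ := fun j => √(m j : ℝ) * ((∫ η, scaleDensity f ψ (a j) η) -
      K * ∫ η, ‖filterFourier ψ η‖ ^ 2)
  set W : ℕ → Ω → ℝ := fun j ω => (√(m j : ℝ))⁻¹ * (∑ k ∈ Finset.Icc 1 (m j), Y j k ω ^ 2 -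
          ∑ k ∈ Finset.Icc 1 (m j), ∫ ω, Y j k ω * Y j k ω ∂P)
  have hWm (j : ℕ) : AEMeasurable (W j) P := by fun_prop
  -- the statistic is the normalized fluctuation `W j` plus the deterministic bias `β j`
  have hdecomp (j : ℕ) : (fun ω => √(m j : ℝ) * (meanSquare X ψ a b m j ω -
      K * ∫ η : ℝ, ‖filterFourier ψ η‖ ^ 2)) = (fun x => x + β j) ∘ W j := by
    ext ω
    have hmj : (0 : ℝ) < m j := by exact_mod_cast hscale.m_pos j
    have hsq : √(m j : ℝ) * (1 / (m j : ℝ)) = (√(m j : ℝ))⁻¹ := by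
      rw [mul_one_div, Real.sqrt_div_self]
    have hsq' : (√(m j : ℝ))⁻¹ * (m j : ℝ) = √(m j : ℝ) := by
      rw [mul_comm, ← div_eq_mul_inv, Real.div_sqrt]
    simp only [Function.comp_apply, W, β, hYY, meanSquare, Finset.sum_const, Nat.card_Icc,
      Nat.add_sub_cancel, nsmul_eq_mul, mul_sub, ← mul_assoc, hsq, hsq', Y]
    ring
  have hYmeas (j : ℕ) : AEMeasurable (fun ω => √(m j : ℝ) * (meanSquare X ψ a b m j ω -
      K * ∫ η : ℝ, ‖filterFourier ψ η‖ ^ 2)) P := by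
    rw [hdecomp]
    exact (hWm j).add_const _
  refine ⟨hYmeas, by fun_prop, ?_⟩
  refine ProbabilityMeasure.tendsto_iff_tendsto_charFun.2 fun t => ?_
  have hV := asymptoticVariance_eq hψ (α := α) hs hc (N := N) (by
    rwa [div_lt_iff₀' hc] at hNπ)
  have hV0 : 0 ≤ asymptoticVariance ψ s₀ α c := by
    rw [hV]
    refine mul_nonneg (by positivity)
      (intervalIntegral.integral_nonneg (by linarith) fun x _ => sq_nonneg _)
  simp only [ProbabilityMeasure.coe_mk, hdecomp, Measure.map_id]
  have hshiftchar (j : ℕ) : charFun (P.map ((fun x => x + β j) ∘ W j)) t =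
      charFun (P.map (W j)) t * Complex.exp (((β j * t : ℝ) : ℂ) * Complex.I) := by
    rw [← AEMeasurable.map_map_of_aemeasurable (by fun_prop) (hWm j), charFun_map_add_const]
    simp [mul_comm]
  simp only [hshiftchar]
  have hexp : Tendsto (fun j => Complex.exp (((β j * t : ℝ) : ℂ) * Complex.I)) atTop (𝓝 1) := by
    have hcont : Continuous fun r : ℝ => Complex.exp (((r * t : ℝ) : ℂ) * Complex.I) := by
      fun_prop
    simpa [Function.comp_def] using (hcont.tendsto 0).comp hbias
  have hfin := (hclt t).mul hexp
  rw [mul_one] at hfin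
  convert hfin using 2
  rw [charFun_gaussianReal, Real.coe_toNNReal _ hV0, hV]
  congr 1
  push_cast
  ring
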